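/- \textbf{Setting.} Let $Q:\mathbb{C}\to\mathbb{R}\cup\{+\infty\}$ be rotation-invariant, lower semicontinuous, and confining in the sense that $\liminf_{|z|\to\infty} \frac{Q(z)}{2\log|z|}>1$. For $n\ge 1$ let $(z_1,\dots,z_n)$ be distributed according to $$d\mathbb{P}_n=\frac1{Z_n}\prod_{1\le j<k\le n}|z_k-z_j|^2\prod_{j=1}^n e^{-nQ(z_j)}\frac{d^2z_j}{\pi},$$ where $Z_n$ is the normalizing constant. The droplet $S$ is the support of the equilibrium measure, that is, of the minimizer of $\iint\log\frac1{|z-w|}\,d\mu(z)\,d\mu(w)+\int Q\,d\mu$ over compactly supported Borel probability measures $\mu$ on $\mathbb{C}$. The obstacle function $\check Q$ is the pointwise supremum of all subharmonic $s:\mathbb{C}\to\mathbb{R}$ with $s\le Q$ and $s(z)\le 2\log|z|+O(1)$ as $|z|\to\infty$, and $S^*=\{Q=\check Q\}$ is the coincidence set. Assume that $Q$ is (finite and) $C^6$-smooth in a neighbourhood of $S^*$ and that, for some $0\le a_0<b_0<t_1<\dots<t_m$, $$S=\{a_0\le|z|\le b_0\},\qquad S^*=S\cup\bigcup_{k=1}^m\{|z|=t_k\}.$$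 Write $\Delta=\frac14(\partial_x^2+\partial_y^2)$; by rotation invariance $\Delta Q(z)$ depends only on $|z|$. Assume $\Delta Q(b_0)>0$ and $\Delta Q(t_k)>0$ for $k=1,\dots,m$, and put $$\vartheta_k=\sqrt{\frac{\Delta Q(b_0)}{\Delta Q(t_k)}},\qquad \rho_k=\frac{b_0}{t_k}.$$ Let $\eta(u)=e^{-1/u}$ for $u>0$, $\eta(u)=0$ for $u\le0$, and $\widehat\eta(u)=\frac{\eta(u)}{\eta(u)+\eta(1-u)}$. Let $\varepsilon>0$ be such that the open $2\varepsilon$-neighbourhoods of the circles $\{|z|=t_k\}$ are pairwise disjoint and $b_0<t_k-\varepsilon$ for all $k$. Define $$h_k(z)=\widehat\eta\Bigl(\tfrac{|z|-(t_k-\varepsilon)}{\varepsilon/2}\Bigr)\,\widehat\eta\Bigl(\tfrac{(t_k+\varepsilon)-|z|}{\varepsilon/2}\Bigr),\qquad N_{n,k}=\sum_{j=1}^n h_k(z_j).$$ \textbf{Statement.} For every $n\ge1$, $\mathbb{P}_n$ is a well-defined probability measure. For all $p,q\in\{1,\dots,m\}$ with $p\ne q$, the series below converge and, as $n\to\infty$,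 $$\mathbb{E}[N_{n,p}]\to\sum_{j=0}^{\infty}\frac{\vartheta_p\rho_p^{2j+1}}{1+\sum_{k=1}^m\vartheta_k\rho_k^{2j+1}},$$ $$\operatorname{Var}[N_{n,p}]\to\sum_{j=0}^{\infty}\frac{\vartheta_p\rho_p^{2j+1}}{\bigl(1+\sum_{k=1}^m\vartheta_k\rho_k^{2j+1}\bigr)^2}\Bigl(1+\sum_{k=1,\,k\ne p}^m\vartheta_k\rho_k^{2j+1}\Bigr),$$ $$\operatorname{Cov}(N_{n,p},N_{n,q})\to-\sum_{j=0}^{\infty}\frac{(\rho_p\rho_q)^{2j+1}}{\bigl(1+\sum_{k=1}^m\vartheta_k\rho_k^{2j+1}\bigr)^2}\,\vartheta_p\vartheta_q .$$ (The first two limits hold for every single $p$, also when $m=1$.) In particular, the limiting covariance is strictly negative: the counts at distinct outposts are asymptotically negatively correlated. -/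

import Mathlib

open MeasureTheory ProbabilityTheory Filter Topology
open scoped ENNReal

noncomputable section

namespace CoulombGas

/-! ### Logarithmic potential theory -/

/-- The integral of an extended-real-valued function, as the difference of the integrals of its
positive and its negative part. It is only applied to functions whose negative part has a finite
integral. -/
def erealIntegral {α : Type*} [MeasurableSpace α] (μ : Measure α) (f : α → EReal) : EReal :=
  ((∫⁻ x, (f x).toENNReal ∂μ : ℝ≥0∞) : EReal) - ((∫⁻ x, (-f x).toENNReal ∂μ : ℝ≥0∞) : EReal)

/-- The weighted logarithmic energy `∬ log (1 / |z - w|) dμ(z) dμ(w) + ∫ Q dμ`; the kernel takes the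
value `+∞` on the diagonal. -/
def weightedEnergy (Q : ℂ → EReal) (μ : Measure ℂ) : EReal :=
  erealIntegral (μ.prod μ) (fun p => -ENNReal.log ‖p.1 - p.2‖ₑ) + erealIntegral μ Q

/-- `σ` minimizes the weighted logarithmic energy over all compactly supported Borel probability
measures on the plane. -/
structure IsEquilibriumMeasure (Q : ℂ → EReal) (σ : Measure ℂ) : Prop where
  isProbabilityMeasure : IsProbabilityMeasure σ
  isCompact_support : IsCompact σ.support
  energy_le : ∀ μ : Measure ℂ, IsProbabilityMeasure μ → IsCompact μ.support →
    weightedEnergy Q σ ≤ weightedEnergy Q μ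

/-- The droplet: the support of the equilibrium measure. -/
def droplet (Q : ℂ → EReal) : Set ℂ :=
  {z | ∃ σ : Measure ℂ, IsEquilibriumMeasure Q σ ∧ z ∈ σ.support}

/-- Real-valued subharmonic functions on the plane: upper semicontinuous with the sub-mean value
property over all circles. -/
structure IsSubharmonic (s : ℂ → ℝ) : Prop where
  upperSemicontinuous : UpperSemicontinuous s
  circleIntegrable : ∀ (c : ℂ) (R : ℝ), 0 < R → CircleIntegrable s c R
  le_circleAverage : ∀ (c : ℂ) (R : ℝ), 0 < R → s c ≤ Real.circleAverage s c R

/-- The competitors in the obstacle problem: subharmonic functions `s ≤ Q` with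
`s(z) ≤ 2 log |z| + O(1)` as `|z| → ∞`. -/
structure IsObstacleCompetitor (Q : ℂ → EReal) (s : ℂ → ℝ) : Prop where
  isSubharmonic : IsSubharmonic s
  le_potential : ∀ z, (s z : EReal) ≤ Q z
  growth : ∃ C : ℝ, ∀ᶠ z in cocompact ℂ, s z ≤ 2 * Real.log ‖z‖ + C

/-- The obstacle function: the pointwise supremum of all competitors. -/
def obstacle (Q : ℂ → EReal) (z : ℂ) : EReal :=
  ⨆ (s : ℂ → ℝ) (_ : IsObstacleCompetitor Q s), (s z : EReal)

/-- The coincidence set of the obstacle problem. -/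
def coincidenceSet (Q : ℂ → EReal) : Set ℂ :=
  {z | Q z = obstacle Q z}

/-- The closed annulus `a ≤ |z| ≤ b` (a closed disk if `a = 0`). -/
def annulus (a b : ℝ) : Set ℂ :=
  {z | a ≤ ‖z‖ ∧ ‖z‖ ≤ b}

/-- The external potentials under consideration, with values in `ℝ ∪ {+∞}`. -/
structure IsAdmissible (Q : ℂ → EReal) : Prop where
  ne_bot : ∀ z, Q z ≠ ⊥
  rotation_invariant : ∀ z w : ℂ, ‖z‖ = ‖w‖ → Q z = Q w
  lowerSemicontinuous : LowerSemicontinuous Q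
  confining : 1 < liminf (fun z => Q z / ((2 * Real.log ‖z‖ : ℝ) : EReal)) (cocompact ℂ)
  smooth : ∃ U : Set ℂ, IsOpen U ∧ coincidenceSet Q ⊆ U ∧ (∀ z ∈ U, Q z ≠ ⊤) ∧
    ContDiffOn ℝ 6 (fun z => (Q z).toReal) U

/-- All outposts lie outside a connected droplet: the droplet is the annulus `a₀ ≤ |z| ≤ b₀`, and the
coincidence set consists of the droplet and of the circles of radii `b₀ < t 0 < t 1 < ⋯`. -/
structure HasOuterOutposts (Q : ℂ → EReal) {m : ℕ} (a₀ b₀ : ℝ) (t : Fin m → ℝ) : Prop where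
  nonneg : 0 ≤ a₀
  lt : a₀ < b₀
  lt_outpost : ∀ k, b₀ < t k
  strictMono : StrictMono t
  droplet_eq : droplet Q = annulus a₀ b₀
  coincidenceSet_eq : coincidenceSet Q = annulus a₀ b₀ ∪ ⋃ k, Metric.sphere (0 : ℂ) (t k)

/-- The quarter Laplacian `(∂²/∂x² + ∂²/∂y²) / 4` of the potential. -/
def quarterLaplacian (Q : ℂ → EReal) (z : ℂ) : ℝ :=
  (1 / 4) * Laplacian.laplacian (fun w : ℂ => (Q w).toReal) z

/-! ### The Coulomb gas -/

/-- The unnormalized density of the gas with respect to Lebesgue measure on `ℂⁿ`,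
`∏_{j < k} |z_k - z_j|² ∏_j e^{-n Q(z_j)} / π`. -/
def gasWeight (Q : ℂ → EReal) (n : ℕ) (z : Fin n → ℂ) : ℝ≥0∞ :=
  (∏ j : Fin n, ∏ k ∈ Finset.Ioi j, ‖z k - z j‖ₑ ^ 2) *
    ∏ j : Fin n, (EReal.exp (-((n : EReal) * Q (z j))) / ENNReal.ofReal Real.pi)

/-- The partition function. -/
def partitionFunction (Q : ℂ → EReal) (n : ℕ) : ℝ≥0∞ :=
  ∫⁻ z : Fin n → ℂ, gasWeight Q n z

/-- The law of the Coulomb gas of `n` particles. -/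
def gas (Q : ℂ → EReal) (n : ℕ) : Measure (Fin n → ℂ) :=
  (partitionFunction Q n)⁻¹ • (volume : Measure (Fin n → ℂ)).withDensity (gasWeight Q n)

/-- The radial cutoff around the circle of radius `t`, equal to `1` for `||z| - t| ≤ ε / 2` and to
`0` for `||z| - t| ≥ ε`. Here `Real.smoothTransition u = η(u) / (η(u) + η(1 - u))` with
`η(u) = e^{-1/u}` for `u > 0` and `η(u) = 0` for `u ≤ 0`. -/
def bump (ε t : ℝ) (z : ℂ) : ℝ :=
  Real.smoothTransition ((‖z‖ - (t - ε)) / (ε / 2)) *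
    Real.smoothTransition (((t + ε) - ‖z‖) / (ε / 2))

/-- The smoothed number of particles near the circle of radius `t`. -/
def particleCount (ε t : ℝ) {n : ℕ} (z : Fin n → ℂ) : ℝ :=
  ∑ j, bump ε t (z j)

/-- `ϑ = √(ΔQ(b₀) / ΔQ(t))`. -/
def theta (Q : ℂ → EReal) (b₀ t : ℝ) : ℝ :=
  Real.sqrt (quarterLaplacian Q (b₀ : ℂ) / quarterLaplacian Q (t : ℂ))

/-- `ρ = b₀ / t`. -/
def rho (b₀ t : ℝ) : ℝ := b₀ / t

/-- `1 + ∑_k ϑ_k ρ_k^{2j+1}`. -/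
def heineDenom (Q : ℂ → EReal) {m : ℕ} (b₀ : ℝ) (t : Fin m → ℝ) (j : ℕ) : ℝ :=
  1 + ∑ k, theta Q b₀ (t k) * rho b₀ (t k) ^ (2 * j + 1)

/-- The `j`-th term of the series for the limiting expectation at the `p`-th outpost. -/
def meanTerm (Q : ℂ → EReal) {m : ℕ} (b₀ : ℝ) (t : Fin m → ℝ) (p : Fin m) (j : ℕ) : ℝ :=
  theta Q b₀ (t p) * rho b₀ (t p) ^ (2 * j + 1) / heineDenom Q b₀ t j

/-- The `j`-th term of the series for the limiting variance at the `p`-th outpost. -/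
def varTerm (Q : ℂ → EReal) {m : ℕ} (b₀ : ℝ) (t : Fin m → ℝ) (p : Fin m) (j : ℕ) : ℝ :=
  theta Q b₀ (t p) * rho b₀ (t p) ^ (2 * j + 1) / heineDenom Q b₀ t j ^ 2 *
    (1 + ∑ k ∈ Finset.univ.erase p, theta Q b₀ (t k) * rho b₀ (t k) ^ (2 * j + 1))

/-- The `j`-th term of the series for minus the limiting covariance at the outposts `p` and `q`. -/
def covTerm (Q : ℂ → EReal) {m : ℕ} (b₀ : ℝ) (t : Fin m → ℝ) (p q : Fin m) (j : ℕ) : ℝ :=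
  (rho b₀ (t p) * rho b₀ (t q)) ^ (2 * j + 1) / heineDenom Q b₀ t j ^ 2 *
    theta Q b₀ (t p) * theta Q b₀ (t q)

end CoulombGas

end

open CoulombGas

/-! Expand the squared Vandermonde determinant by the Leibniz formula. Against a radial weight and
an observable of the moduli, a pair of distinct permutations integrates to zero (rotate one
particle), and all diagonal pairs contribute equally. So for symmetric observables of the moduli the
particles may be treated as independent, with densities proportional to `|z|^(2j) e^{-nQ}`, `j < n`
(`IsGasWeight.integral_vandermondeWeight_mul`), and means and covariances of radial linear
statistics become single sums over `j` (`integral_linearStatistic`, `covariance_linearStatistic`).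

Count from the top, `j = n - 1 - i`. In polar coordinates the density is proportional to
`r^{-(2i+1)} (r² e^{-Q})^n`, so for fixed `i` it concentrates at the maxima of `r² e^{-Q}`. These
are exactly `b₀` and the `t_k`; the second derivative of `Q - 2 log r` there is `4ΔQ`, and Laplace's
method (`tendsto_laplace`) distributes the mass in the proportions `1 : ϑ_k ρ_k^{2i+1}`. In the
limit the `i`-th variable from the top contributes a Bernoulli variable to each outpost, with
success probability `meanTerm`, and it can visit only one outpost: whence variances `π_p (1 - π_p)`
and covariances `-π_p π_q`. A geometric bound in `i`, uniform in `n` (`exists_gasMean_le`), allows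
summation over `i` (`tendsto_sum_reflect`).

The location of the maxima (`exists_max_sq_mul_boltzmann`) is the potential-theoretic part. A
maximizer of `r^l e^{-Q}`, `0 < l ≤ 2`, lies in the coincidence set, because the logarithm touching
`Q` there is, after truncation, a competitor. For all but finitely many `l < 2` it cannot be an
outpost, so it is at most `b₀`; letting `l → 2` shows that `r² e^{-Q}` attains its global maximum on
`[0, b₀]`. A maximum principle at infinity (`IsSubharmonic.le_log_of_growth`) turns every
coincidence point farther out into a maximizer as well, and `ΔQ(b₀) > 0` excludes maximizers below
`b₀`. -/

noncomputable section

namespace CoulombGas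

/-! ### The Boltzmann factor -/

section Boltzmann

/-- The Boltzmann factor `e^{-Q}` as a real-valued function. -/
def boltzmann (Q : ℂ → EReal) (z : ℂ) : ℝ := (EReal.exp (-Q z)).toReal

variable {Q : ℂ → EReal}

lemma boltzmann_nonneg (z : ℂ) : 0 ≤ boltzmann Q z := ENNReal.toReal_nonneg

namespace IsAdmissible

lemma ofReal_boltzmann (hQ : IsAdmissible Q) (z : ℂ) :
    ENNReal.ofReal (boltzmann Q z) = EReal.exp (-Q z) := by
  rw [boltzmann, ENNReal.ofReal_toReal]
  simp [hQ.ne_bot z]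

lemma exp_neg_nsmul (hQ : IsAdmissible Q) {n : ℕ} (hn : 0 < n) (z : ℂ) :
    EReal.exp (-((n : EReal) * Q z)) = ENNReal.ofReal (boltzmann Q z ^ n) := by
  rw [ENNReal.ofReal_pow (boltzmann_nonneg z), hQ.ofReal_boltzmann]
  have h := hQ.ne_bot z
  induction hq : Q z using EReal.rec with
  | bot => exact absurd hq h
  | top =>
    have : ((n : EReal) * ⊤) = ⊤ := EReal.mul_top_of_pos (by exact_mod_cast hn)
    rw [this]
    simp [hn.ne']
  | coe x =>
    have : -((n : EReal) * (x : EReal)) = ((n * (-x) : ℝ) : EReal) := by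
      push_cast
      rw [mul_neg]
    rw [this, ← EReal.coe_neg, EReal.exp_coe, EReal.exp_coe, Real.exp_nat_mul,
      ENNReal.ofReal_pow (Real.exp_pos _).le]

lemma boltzmann_norm (hQ : IsAdmissible Q) (z : ℂ) :
    boltzmann Q (‖z‖ : ℂ) = boltzmann Q z := by
  rw [boltzmann, boltzmann, hQ.rotation_invariant (‖z‖ : ℂ) z (by simp)]

lemma boltzmann_lt_iff (hQ : IsAdmissible Q) {z : ℂ} {y : ℝ} (hy : 0 < y) :
    boltzmann Q z < y ↔ ((-Real.log y : ℝ) : EReal) < Q z := by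
  have h1 : boltzmann Q z < y ↔ EReal.exp (-Q z) < ENNReal.ofReal y := by
    rw [← hQ.ofReal_boltzmann, ENNReal.ofReal_lt_ofReal_iff hy]
  have h2 : ENNReal.ofReal y = EReal.exp ((Real.log y : ℝ) : EReal) := by
    rw [EReal.exp_coe, Real.exp_log hy]
  rw [h1, h2, EReal.exp_lt_exp_iff, EReal.coe_neg, EReal.neg_lt_comm]

lemma boltzmann_le_iff (hQ : IsAdmissible Q) {z : ℂ} {y : ℝ} (hy : 0 < y) :
    boltzmann Q z ≤ y ↔ ((-Real.log y : ℝ) : EReal) ≤ Q z := by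
  have h1 : boltzmann Q z ≤ y ↔ EReal.exp (-Q z) ≤ ENNReal.ofReal y := by
    rw [← hQ.ofReal_boltzmann, ENNReal.ofReal_le_ofReal_iff hy.le]
  have h2 : ENNReal.ofReal y = EReal.exp ((Real.log y : ℝ) : EReal) := by
    rw [EReal.exp_coe, Real.exp_log hy]
  rw [h1, h2, EReal.exp_le_exp_iff, EReal.coe_neg, EReal.neg_le]

lemma le_boltzmann_iff (hQ : IsAdmissible Q) {z : ℂ} {y : ℝ} (hy : 0 < y) :
    y ≤ boltzmann Q z ↔ Q z ≤ ((-Real.log y : ℝ) : EReal) := by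
  rw [← not_lt, hQ.boltzmann_lt_iff hy, not_lt]

/-- Away from the coincidence set `Q` need not be continuous; semicontinuity is enough for
measurability and for maxima on compact sets. -/
lemma upperSemicontinuous_boltzmann (hQ : IsAdmissible Q) :
    UpperSemicontinuous (boltzmann Q) := by
  intro z y hy
  have hy0 : 0 < y := (boltzmann_nonneg z).trans_lt hy
  have := hQ.lowerSemicontinuous z _ ((hQ.boltzmann_lt_iff hy0).1 hy)
  filter_upwards [this] with w hw using (hQ.boltzmann_lt_iff hy0).2 hw

lemma measurable_boltzmann (hQ : IsAdmissible Q) : Measurable (boltzmann Q) :=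
  hQ.upperSemicontinuous_boltzmann.measurable

/-- The strict inequality in the confinement hypothesis leaves room for some `a > 1`. This excess
makes `r² e^{-Q}` decay at infinity and the moments up to order `2(n - 1)` finite. -/
lemma exists_boltzmann_le_rpow (hQ : IsAdmissible Q) :
    ∃ a : ℝ, 1 < a ∧ ∃ R : ℝ, 1 < R ∧ ∀ z : ℂ, R ≤ ‖z‖ → boltzmann Q z ≤ ‖z‖ ^ (-(2 * a)) := by
  obtain ⟨a, ha1, ha2⟩ := EReal.lt_iff_exists_real_btwn.1 hQ.confining
  have ha : 1 < a := by exact_mod_cast ha1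
  have hev := eventually_lt_of_lt_liminf ha2
  rw [← Metric.cobounded_eq_cocompact, ← comap_norm_atTop, eventually_comap] at hev
  obtain ⟨R, hR⟩ := eventually_atTop.1 hev
  refine ⟨a, ha, max R 2, lt_max_of_lt_right one_lt_two, fun z hz => ?_⟩
  have h2 : 2 ≤ ‖z‖ := (le_max_right _ _).trans hz
  have hpos : 0 < ‖z‖ := by linarith
  have hlog : 0 < 2 * Real.log ‖z‖ := by
    have := Real.log_pos (by linarith : 1 < ‖z‖)
    linarith
  have h := hR ‖z‖ ((le_max_left _ _).trans hz) z rfl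
  rw [EReal.lt_div_iff (by exact_mod_cast hlog) (EReal.coe_ne_top _)] at h
  rw [hQ.boltzmann_le_iff (Real.rpow_pos_of_pos hpos _), Real.log_rpow hpos]
  refine le_trans (le_of_eq ?_) h.le
  rw [← EReal.coe_mul]
  congr 1
  ring

lemma exists_boltzmann_le (hQ : IsAdmissible Q) : ∃ B : ℝ, 0 < B ∧ ∀ z, boltzmann Q z ≤ B := by
  obtain ⟨a, ha, R, hR, h⟩ := hQ.exists_boltzmann_le_rpow
  obtain ⟨B, hB⟩ := (hQ.upperSemicontinuous_boltzmann.upperSemicontinuousOn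
    (Metric.closedBall 0 R)).bddAbove_of_isCompact (isCompact_closedBall 0 R)
  refine ⟨max B 1, lt_max_of_lt_right one_pos, fun z => ?_⟩
  rcases le_total ‖z‖ R with hz | hz
  · exact (hB ⟨z, by simpa using hz, rfl⟩).trans (le_max_left _ _)
  · refine (h z hz).trans (le_trans ?_ (le_max_right _ _))
    exact Real.rpow_le_one_of_one_le_of_nonpos (by linarith) (by linarith)

lemma boltzmann_eq_exp (hQ : IsAdmissible Q) {z : ℂ} (h : Q z ≠ ⊤) :
    boltzmann Q z = Real.exp (-(Q z).toReal) := by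
  lift Q z to ℝ using ⟨h, hQ.ne_bot z⟩ with x hx
  rw [boltzmann, ← hx, ← EReal.coe_neg, EReal.exp_coe, ENNReal.toReal_ofReal (Real.exp_pos _).le,
    EReal.toReal_coe]

end IsAdmissible

/-- The product of a nonnegative continuous and a nonnegative upper semicontinuous function is upper
semicontinuous. -/
lemma upperSemicontinuousOn_mul {X : Type*} [TopologicalSpace X] {f g : X → ℝ} {s : Set X}
    (hf : ContinuousOn f s) (hf0 : ∀ x ∈ s, 0 ≤ f x) (hg : UpperSemicontinuousOn g s) :
    UpperSemicontinuousOn (fun x => f x * g x) s := by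
  intro x hx y hy
  -- A number `t > g x` with `f x * t < y` decouples the factors: near `x`, continuity keeps `f * t`
  -- below `y` and semicontinuity keeps `g` below `t`.
  have hc : Tendsto (fun t : ℝ => f x * t) (𝓝[>] (g x)) (𝓝 (f x * g x)) :=
    ((continuous_const.mul continuous_id).tendsto (g x)).mono_left nhdsWithin_le_nhds
  obtain ⟨t, ht, htg⟩ := ((hc.eventually_lt_const hy).and self_mem_nhdsWithin).exists
  have h1 : ∀ᶠ z in 𝓝[s] x, f z * t < y :=
    ((hf x hx).mul_const t).eventually_lt_const ht
  filter_upwards [h1, hg x hx t htg, self_mem_nhdsWithin] with z hz hgz hzs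
  exact (mul_le_mul_of_nonneg_left hgz.le (hf0 z hzs)).trans_lt hz

end Boltzmann

/-! ### Radial functions and their Laplacian -/

section Laplacian

/-- The second directional derivative as the derivative of the directional derivative. -/
lemma hasDerivAt_fderiv_line {f : ℂ → ℝ} {x : ℂ} (hf : ContDiffAt ℝ 2 f x) (v : ℂ) :
    HasDerivAt (fun t : ℝ => fderiv ℝ f (x + t * v) v) (iteratedFDeriv ℝ 2 f x ![v, v]) 0 := by
  have hd : DifferentiableAt ℝ (fderiv ℝ f) x :=
    (hf.fderiv_right (m := 1) (by norm_num)).differentiableAt (by norm_num)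
  have hl : HasDerivAt (fun t : ℝ => x + t * v) v 0 := by
    have := ((hasDerivAt_id (0 : ℝ)).ofReal_comp.mul_const v).const_add x
    simpa using this
  have hx : x = x + ((0 : ℝ) : ℂ) * v := by simp
  have h1 : HasFDerivAt (fderiv ℝ f) (fderiv ℝ (fderiv ℝ f) x) (x + ((0 : ℝ) : ℂ) * v) :=
    hx ▸ hd.hasFDerivAt
  have h2 : HasDerivAt (fun t : ℝ => fderiv ℝ f (x + t * v)) (fderiv ℝ (fderiv ℝ f) x v) 0 :=
    h1.comp_hasDerivAt (0 : ℝ) hl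
  have h3 : HasDerivAt (fun t : ℝ => fderiv ℝ f (x + t * v) v) (fderiv ℝ (fderiv ℝ f) x v v) 0 :=
    (ContinuousLinearMap.apply ℝ ℝ v).hasFDerivAt.comp_hasDerivAt (0 : ℝ) h2
  have h4 := iteratedFDeriv_two_apply (𝕜 := ℝ) f x ![v, v]
  exact h4 ▸ h3

/-- The Laplacian of a radial function in polar coordinates, on the positive real axis. -/
lemma laplacian_radial {f : ℂ → ℝ} (hrad : ∀ z, f z = f (‖z‖ : ℂ)) {s : ℝ} (hs : 0 < s)
    (hf : ContDiffAt ℝ 2 f (s : ℂ)) :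
    Laplacian.laplacian f (s : ℂ) =
      deriv (deriv (fun r : ℝ => f (r : ℂ))) s + deriv (fun r : ℝ => f (r : ℂ)) s / s := by
  rw [InnerProductSpace.laplacian_eq_iteratedFDeriv_complexPlane]
  have hev : ∀ᶠ z in 𝓝 (s : ℂ), DifferentiableAt ℝ f z := by
    have := hf.eventually (by simp)
    filter_upwards [this] with z hz using hz.differentiableAt (by norm_num)
  have hlim : ∀ v : ℂ, Tendsto (fun t : ℝ => (s : ℂ) + t * v) (𝓝 0) (𝓝 (s : ℂ)) := by
    intro v
    have : Continuous (fun t : ℝ => (s : ℂ) + t * v) := by fun_prop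
    simpa using this.tendsto 0
  have hline : ∀ v : ℂ, ∀ᶠ t : ℝ in 𝓝 (0 : ℝ),
      HasDerivAt (fun u : ℝ => f ((s : ℂ) + u * v)) (fderiv ℝ f ((s : ℂ) + (t : ℂ) * v) v) t := by
    intro v
    filter_upwards [(hlim v).eventually hev] with t ht
    have hl : HasDerivAt (fun t : ℝ => (s : ℂ) + t * v) v t := by
      simpa using ((hasDerivAt_id t).ofReal_comp.mul_const v).const_add (s : ℂ)
    exact ht.hasFDerivAt.comp_hasDerivAt t hl
  set g : ℝ → ℝ := fun r => f (r : ℂ) with hg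
  have hgC : ContDiffAt ℝ 2 g s := by
    exact hf.comp s (Complex.ofRealCLM.contDiff.contDiffAt)
  have hg1 : DifferentiableAt ℝ (deriv g) s := by
    have h1 : DifferentiableAt ℝ (fderiv ℝ g) s :=
      (hgC.fderiv_right (m := 1) (by norm_num)).differentiableAt (by norm_num)
    have h2 : deriv g = fun r => fderiv ℝ g r 1 := by
      ext r
      exact fderiv_apply_one_eq_deriv.symm
    rw [h2]
    exact h1.clm_apply (differentiableAt_const 1)
  have hgev : ∀ᶠ r in 𝓝 s, DifferentiableAt ℝ g r := by
    filter_upwards [hgC.eventually (by simp)] with z hz using hz.differentiableAt (by norm_num)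
  have e1 : iteratedFDeriv ℝ 2 f (s : ℂ) ![1, 1] = deriv (deriv g) s := by
    have h1 := hasDerivAt_fderiv_line hf 1
    have hsh : Tendsto (fun t : ℝ => s + t) (𝓝 0) (𝓝 s) := by
      have : Continuous (fun t : ℝ => s + t) := by fun_prop
      simpa using this.tendsto 0
    have h2 : (fun t : ℝ => deriv g (s + t)) =ᶠ[𝓝 0]
        fun t : ℝ => fderiv ℝ f ((s : ℂ) + t * 1) 1 := by
      filter_upwards [hline 1, hsh.eventually hgev] with t ht ht2
      have h3 : HasDerivAt (fun t : ℝ => g (s + t)) (deriv g (s + t)) t :=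
        HasDerivAt.comp_const_add s t ht2.hasDerivAt
      refine h3.unique ?_
      simpa [hg] using ht
    have h4 : HasDerivAt (fun t : ℝ => deriv g (s + t)) (deriv (deriv g) s) 0 := by
      apply HasDerivAt.comp_const_add s 0
      simpa using hg1.hasDerivAt
    exact (h1.congr_of_eventuallyEq h2).unique h4
  -- On the vertical line through `s` the function is `g(√(s² + y²))`, with derivative `k(y) * y`
  -- where `k = g'(r)/r`. Its derivative at `0` is `k(0)` by mere continuity of `k`.
  have e2 : iteratedFDeriv ℝ 2 f (s : ℂ) ![Complex.I, Complex.I] = deriv g s / s := by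
    have h1 := hasDerivAt_fderiv_line hf Complex.I
    have hn : ∀ y : ℝ, ‖(s : ℂ) + y * Complex.I‖ = Real.sqrt (s ^ 2 + y ^ 2) := by
      intro y
      rw [Complex.norm_add_mul_I]
    have hpos : ∀ y : ℝ, 0 < s ^ 2 + y ^ 2 := fun y => by positivity
    have hsh : ContinuousAt (fun y : ℝ => Real.sqrt (s ^ 2 + y ^ 2)) 0 := by fun_prop
    have hs0 : Real.sqrt (s ^ 2 + (0 : ℝ) ^ 2) = s := by simp [Real.sqrt_sq hs.le]
    have hsh' : Tendsto (fun y : ℝ => Real.sqrt (s ^ 2 + y ^ 2)) (𝓝 0) (𝓝 s) := by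
      have := hsh.tendsto
      rwa [hs0] at this
    have h2 : (fun y : ℝ => deriv g (Real.sqrt (s ^ 2 + y ^ 2)) / Real.sqrt (s ^ 2 + y ^ 2) * y)
        =ᶠ[𝓝 0] fun y : ℝ => fderiv ℝ f ((s : ℂ) + y * Complex.I) Complex.I := by
      filter_upwards [hline Complex.I, hsh'.eventually hgev] with y hy hy2
      have h3 : HasDerivAt (fun y : ℝ => Real.sqrt (s ^ 2 + y ^ 2))
          (2 * y / (2 * Real.sqrt (s ^ 2 + y ^ 2))) y := by
        have h6 : HasDerivAt (fun y : ℝ => s ^ 2 + y ^ 2) (2 * y) y := by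
          simpa using ((hasDerivAt_id' y).fun_pow 2).const_add (s ^ 2)
        exact h6.sqrt (hpos y).ne'
      have h4 := HasDerivAt.comp y hy2.hasDerivAt h3
      have h5 : g ∘ (fun y : ℝ => Real.sqrt (s ^ 2 + y ^ 2)) =
          fun t : ℝ => f ((s : ℂ) + t * Complex.I) := by
        ext y
        rw [hrad ((s : ℂ) + y * Complex.I), hn]
        rfl
      rw [h5] at h4
      rw [← h4.unique hy]
      have := (Real.sqrt_pos.2 (hpos y)).ne'
      field_simp
    have h3 := h1.congr_of_eventuallyEq h2
    have hk : ContinuousAt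
        (fun y : ℝ => deriv g (Real.sqrt (s ^ 2 + y ^ 2)) / Real.sqrt (s ^ 2 + y ^ 2)) 0 := by
      refine ContinuousAt.div ?_ hsh (by rw [hs0]; exact hs.ne')
      refine ContinuousAt.comp (g := deriv g) ?_ hsh
      rw [hs0]
      exact hg1.continuousAt
    have h4 : HasDerivAt
        (fun y : ℝ => deriv g (Real.sqrt (s ^ 2 + y ^ 2)) / Real.sqrt (s ^ 2 + y ^ 2) * y)
        (deriv g s / s) 0 := by
      rw [hasDerivAt_iff_tendsto_slope]
      have := hk.tendsto.mono_left (nhdsWithin_le_nhds (s := {0}ᶜ))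
      rw [hs0] at this
      refine this.congr' ?_
      filter_upwards [self_mem_nhdsWithin] with y hy
      have hy' : y ≠ 0 := hy
      rw [slope_def_field]
      rw [mul_zero, sub_zero, sub_zero, mul_div_cancel_right₀ _ hy']
    exact h3.unique h4
  simp only [e1, e2]

/-- Second-order Taylor expansion at a critical point. -/
lemma isLittleO_sub_quadratic {g : ℝ → ℝ} {s κ : ℝ} (hg : ∀ᶠ r in 𝓝 s, DifferentiableAt ℝ g r)
    (h0 : g s = 0) (h1 : deriv g s = 0) (h2 : HasDerivAt (deriv g) κ s) :
    (fun r => g r - κ / 2 * (r - s) ^ 2) =o[𝓝 s] fun r => (r - s) ^ 2 := by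
  obtain ⟨δ, hδ, hball⟩ := Metric.eventually_nhds_iff_ball.1 hg
  have hnhds : 𝓝[Metric.ball s δ] s = 𝓝 s :=
    Metric.isOpen_ball.nhdsWithin_eq (Metric.mem_ball_self hδ)
  -- Differentiability of `g'` at `s` gives an `o(r - s)` error for the derivative, which integrates
  -- to `o((r - s)²)`.
  have key := Convex.isLittleO_pow_succ_real (f := fun r => g r - κ / 2 * (r - s) ^ 2)
    (f' := fun r => deriv g r - κ * (r - s)) (s := Metric.ball s δ) (x₀ := s) (n := 1)
    (convex_ball s δ) (Metric.mem_ball_self hδ) ?_ ?_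
  · rw [hnhds] at key
    simpa [h0] using key
  · intro r hr
    have hd : HasDerivAt (fun r => κ / 2 * (r - s) ^ 2) (κ * (r - s)) r := by
      have h := (((hasDerivAt_id' r).sub_const s).fun_pow 2).const_mul (κ / 2)
      have e : κ / 2 * (((2 : ℕ) : ℝ) * (r - s) ^ (2 - 1) * 1) = κ * (r - s) := by
        norm_num
        ring
      rwa [e] at h
    exact ((hball r hr).hasDerivAt.sub hd).hasDerivWithinAt
  · rw [hnhds]
    have := hasDerivAt_iff_isLittleO.1 h2
    simp only [h1, smul_eq_mul, sub_zero] at this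
    simpa [mul_comm] using this

end Laplacian

/-! ### Subharmonic functions -/

section Subharmonic

/-- Jensen's formula evaluates the average as `log R + log⁺ (|c| / R)`, and `log⁺ ≥ log`. -/
lemma log_norm_le_circleAverage (c : ℂ) {R : ℝ} (hR : 0 < R) (hc : c ≠ 0) :
    Real.log ‖c‖ ≤ Real.circleAverage (fun z => Real.log ‖z‖) c R := by
  have h := circleAverage_log_norm_sub_const_eq_log_radius_add_posLog (a := 0) (c := c) hR.ne'
  simp only [sub_zero] at h
  rw [h]
  have hc' : 0 < ‖c‖ := norm_pos_iff.2 hc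
  have : Real.log (R⁻¹ * ‖c‖) ≤ Real.posLog (R⁻¹ * ‖c‖) := le_max_right _ _
  rw [Real.log_mul (by positivity) hc'.ne', Real.log_inv] at this
  linarith

lemma circleAverage_log_norm_of_le {c : ℂ} {R : ℝ} (hR : 0 < R) (hc : R ≤ ‖c‖) :
    Real.circleAverage (fun z => Real.log ‖z‖) c R = Real.log ‖c‖ := by
  have h := circleAverage_log_norm_sub_const_eq_log_radius_add_posLog (a := 0) (c := c) hR.ne'
  simp only [sub_zero] at h
  have hc' : 0 < ‖c‖ := hR.trans_le hc
  have h1 : 1 ≤ R⁻¹ * ‖c‖ := by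
    rw [inv_mul_eq_div, one_le_div hR]
    exact hc
  rw [h, Real.posLog_eq_log (h1.trans (le_abs_self _)), Real.log_mul (by positivity) hc'.ne',
    Real.log_inv]
  ring

/-- The surplus `R²` makes `‖z‖²` a strictly subharmonic perturbation in the maximum principle
below. -/
lemma circleAverage_norm_sq (c : ℂ) (R : ℝ) :
    Real.circleAverage (fun z => ‖z‖ ^ 2) c R = ‖c‖ ^ 2 + R ^ 2 := by
  have h : ∀ θ : ℝ, ‖circleMap c R θ‖ ^ 2 =
      (‖c‖ ^ 2 + R ^ 2) + (2 * R * c.re) * Real.cos θ + (2 * R * c.im) * Real.sin θ := by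
    intro θ
    rw [← Complex.normSq_eq_norm_sq, ← Complex.normSq_eq_norm_sq, circleMap, Complex.exp_mul_I,
      ← Complex.ofReal_cos, ← Complex.ofReal_sin, Complex.normSq_apply, Complex.normSq_apply]
    simp only [Complex.add_re, Complex.mul_re, Complex.ofReal_re, Complex.ofReal_im,
      Complex.I_re, Complex.I_im, Complex.add_im, Complex.mul_im]
    have := Real.sin_sq_add_cos_sq θ
    linear_combination R ^ 2 * this
  rw [Real.circleAverage_def]
  simp only [h]
  rw [intervalIntegral.integral_add, intervalIntegral.integral_add,
    intervalIntegral.integral_const_mul, intervalIntegral.integral_const_mul, integral_cos,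
    integral_sin, intervalIntegral.integral_const]
  · simp only [Real.sin_two_pi, Real.sin_zero, Real.cos_two_pi, Real.cos_zero, smul_eq_mul]
    field_simp
    ring
  all_goals exact Continuous.intervalIntegrable (by fun_prop) _ _

/-- The functions `λ log⁺ (|z| / κ) + B` are subharmonic. -/
lemma isSubharmonic_posLog {l κ : ℝ} (hl : 0 ≤ l) (hκ : 0 < κ) (B : ℝ) :
    IsSubharmonic (fun z : ℂ => l * Real.posLog (‖z‖ / κ) + B) := by
  have hcont : Continuous (fun z : ℂ => Real.posLog (‖z‖ / κ)) :=
    Real.continuous_posLog.comp (continuous_norm.div_const κ)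
  have hcont' : Continuous (fun z : ℂ => l * Real.posLog (‖z‖ / κ) + B) := by fun_prop
  have hint : ∀ {f : ℂ → ℝ}, Continuous f → ∀ c R, CircleIntegrable f c R := fun hf c R =>
    (hf.comp (continuous_circleMap c R)).intervalIntegrable _ _
  refine ⟨hcont'.upperSemicontinuous, fun c R _ => hint hcont' c R, fun c R hR => ?_⟩
  have hscale : Real.circleAverage (fun z : ℂ => Real.posLog (‖z‖ / κ)) c R =
      Real.circleAverage (fun z : ℂ => Real.posLog ‖z‖) (c / κ) (R / κ) := by
    rw [Real.circleAverage_def, Real.circleAverage_def]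
    have : ∀ θ : ℝ, ‖circleMap c R θ‖ / κ = ‖circleMap (c / κ) (R / κ) θ‖ := by
      intro θ
      have : circleMap (c / κ) (R / κ) θ = circleMap c R θ / κ := by
        simp only [circleMap, Complex.ofReal_div]
        ring
      rw [this, norm_div, Complex.norm_real, Real.norm_of_nonneg hκ.le]
    simp only [this]
  have hpc : Continuous (fun z : ℂ => Real.posLog ‖z‖) :=
    Real.continuous_posLog.comp continuous_norm
  have hRκ : 0 < R / κ := by positivity
  have key : Real.posLog (‖c‖ / κ) ≤ Real.circleAverage (fun z : ℂ => Real.posLog (‖z‖ / κ)) c R := by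
    rw [hscale]
    have hn : ‖c‖ / κ = ‖c / κ‖ := by
      rw [norm_div, Complex.norm_real, Real.norm_of_nonneg hκ.le]
    rw [hn]
    have h0 : 0 ≤ Real.circleAverage (fun z : ℂ => Real.posLog ‖z‖) (c / κ) (R / κ) :=
      Real.circleAverage_nonneg_of_nonneg fun z _ => Real.posLog_nonneg
    refine max_le h0 ?_
    -- At the origin `Real.log 0 = 0`, so the bound reduces to nonnegativity of the average.
    by_cases hc : c / κ = 0
    · simpa [hc] using h0
    · refine (log_norm_le_circleAverage _ hRκ hc).trans ?_
      refine Real.circleAverage_mono ?_ (hint hpc _ _) fun z _ => le_max_right _ _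
      simpa using circleIntegrable_log_norm_sub_const (a := 0) (c := c / κ) (R / κ)
  have : Real.circleAverage (fun z : ℂ => l * Real.posLog (‖z‖ / κ) + B) c R =
      l * Real.circleAverage (fun z : ℂ => Real.posLog (‖z‖ / κ)) c R + B := by
    rw [Real.circleAverage_fun_add (hint (by fun_prop) _ _) (hint continuous_const _ _),
      Real.circleAverage_const]
    have := Real.circleAverage_fun_smul (a := l) (f := fun z : ℂ => Real.posLog (‖z‖ / κ))
      (c := c) (R := R)
    simp only [smul_eq_mul] at this
    rw [this]
  rw [this]
  gcongr

/-- A maximum principle at infinity: a subharmonic function that grows at most like `2 log |z|` and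
lies below `2 log |z| + c` on the circle of radius `r` does so outside the circle. -/
lemma IsSubharmonic.le_log_of_growth {s : ℂ → ℝ} (hs : IsSubharmonic s)
    (hgrowth : ∃ C : ℝ, ∀ᶠ z in cocompact ℂ, s z ≤ 2 * Real.log ‖z‖ + C) {r c : ℝ} (hr : 0 < r)
    (hbd : ∀ z, ‖z‖ = r → s z ≤ 2 * Real.log r + c) {z : ℂ} (hz : r ≤ ‖z‖) :
    s z ≤ 2 * Real.log ‖z‖ + c := by
  obtain ⟨C, hC⟩ := hgrowth
  rw [← Metric.cobounded_eq_cocompact, ← comap_norm_atTop, eventually_comap] at hC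
  -- Comparison with `(2 + η) log |z|`: the surplus `η log (|z| / r)` absorbs the unknown constant
  -- `C` on a large circle of radius `R`. Afterwards `η → 0`.
  have step : ∀ η : ℝ, 0 < η → s z ≤ 2 * Real.log ‖z‖ + c + η * Real.log (‖z‖ / r) := by
    intro η hη
    have hlim : Tendsto (fun R : ℝ => c + η * Real.log (R / r)) atTop atTop :=
      tendsto_atTop_add_const_left _ _
        ((Real.tendsto_log_atTop.comp (tendsto_id.atTop_div_const hr)).const_mul_atTop hη)
    obtain ⟨R, hR1, hR2, hR3⟩ := (hC.and ((hlim.eventually_ge_atTop C).and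
      (eventually_gt_atTop ‖z‖))).exists
    have hrR : r < R := hz.trans_lt hR3
    set v : ℂ → ℝ := fun y => (2 + η) * Real.log ‖y‖ + (c - η * Real.log r) with hv
    have hbR : ∀ y, ‖y‖ = R → s y ≤ v y := by
      intro y hy
      have h1 := hR1 y hy
      rw [Real.log_div (hr.trans hrR).ne' hr.ne'] at hR2
      simp only [hv, hy] at h1 ⊢
      linarith
    have hbr : ∀ y, ‖y‖ = r → s y ≤ v y := by
      intro y hy
      have h1 := hbd y hy
      simp only [hv, hy] at h1 ⊢
      linarith
    -- The term `δ (|z|² - R²)` is nonpositive on the annulus and makes the difference strictly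
    -- subharmonic, so its maximum must sit on the boundary. Afterwards `δ → 0`.
    have hδ : ∀ δ : ℝ, 0 < δ → s z - v z + δ * (‖z‖ ^ 2 - R ^ 2) ≤ 0 := by
      intro δ hδ
      set K : Set ℂ := annulus r R with hK
      have hKc : IsCompact K := by
        refine (isCompact_closedBall (0 : ℂ) R).of_isClosed_subset ?_ fun y hy => by
          simpa using hy.2
        exact (isClosed_le continuous_const continuous_norm).inter
          (isClosed_le continuous_norm continuous_const)
      have hpos : ∀ y ∈ K, 0 < ‖y‖ := fun y hy => hr.trans_le hy.1
      have hwc : ContinuousOn (fun y : ℂ => -v y + δ * (‖y‖ ^ 2 - R ^ 2)) K := by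
        have : ContinuousOn (fun y : ℂ => Real.log ‖y‖) K :=
          continuous_norm.continuousOn.log fun y hy => (hpos y hy).ne'
        simp only [hv]
        fun_prop
      have hw : UpperSemicontinuousOn
          (fun y : ℂ => s y + (-v y + δ * (‖y‖ ^ 2 - R ^ 2))) K :=
        (hs.upperSemicontinuous.upperSemicontinuousOn K).add hwc.upperSemicontinuousOn
      obtain ⟨y, hyK, hmax⟩ := hw.exists_isMaxOn (Set.nonempty_of_mem (show z ∈ K from ⟨hz, hR3.le⟩)) hKc
      have hzy := hmax (show z ∈ K from ⟨hz, hR3.le⟩)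
      simp only [Set.mem_ofPred_eq] at hzy
      suffices h : s y + (-v y + δ * (‖y‖ ^ 2 - R ^ 2)) ≤ 0 by linarith
      have hsq : ‖y‖ ^ 2 ≤ R ^ 2 := pow_le_pow_left₀ (norm_nonneg _) hyK.2 2
      have hδ' : δ * (‖y‖ ^ 2 - R ^ 2) ≤ 0 :=
        mul_nonpos_of_nonneg_of_nonpos hδ.le (by linarith)
      rcases hyK.1.eq_or_lt with h1 | h1
      · linarith [hbr y h1.symm]
      rcases hyK.2.eq_or_lt with h2 | h2
      · linarith [hbR y h2]
      -- At an interior maximum `y`, average the bound on `s` over a small circle around `y`: the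
      -- logarithm is harmonic there and reproduces its value, while `-δ |x|²` loses `δ ρ²`. This
      -- contradicts the sub-mean value property.
      exfalso
      obtain ⟨ρ, hρ, hρ'⟩ : ∃ ρ : ℝ, 0 < ρ ∧ ρ < min (‖y‖ - r) (R - ‖y‖) :=
        exists_between (lt_min (by linarith) (by linarith))
      have hρ1 := hρ'.trans_le (min_le_left _ _)
      have hρ2 := hρ'.trans_le (min_le_right _ _)
      set M : ℝ := s y + (-v y + δ * (‖y‖ ^ 2 - R ^ 2)) with hM
      have hle : ∀ x ∈ Metric.sphere y |ρ|, s x ≤ (2 + η) * Real.log ‖x‖ +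
          ((c - η * Real.log r + δ * R ^ 2 + M) + (-δ) * ‖x‖ ^ 2) := by
        intro x hx
        rw [abs_of_pos hρ, mem_sphere_iff_norm] at hx
        have hx1 : ‖x‖ ≤ ‖y‖ + ρ := by
          calc ‖x‖ = ‖y + (x - y)‖ := by congr 1; ring
            _ ≤ ‖y‖ + ‖x - y‖ := norm_add_le _ _
            _ = _ := by rw [hx]
        have hx2 : ‖y‖ ≤ ‖x‖ + ρ := by
          calc ‖y‖ = ‖x + (y - x)‖ := by congr 1; ring
            _ ≤ ‖x‖ + ‖y - x‖ := norm_add_le _ _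
            _ = _ := by rw [norm_sub_rev, hx]
        have := hmax (show x ∈ K from ⟨by linarith, by linarith⟩)
        simp only [Set.mem_ofPred_eq, hv] at this
        simp only [hM, hv]
        linarith
      have hi1 : CircleIntegrable (fun x : ℂ => Real.log ‖x‖) y ρ := by
        simpa using circleIntegrable_log_norm_sub_const (a := 0) (c := y) ρ
      have hi2 : CircleIntegrable (fun x : ℂ => ‖x‖ ^ 2) y ρ :=
        (Continuous.comp (g := fun x : ℂ => ‖x‖ ^ 2) (by fun_prop)
          (continuous_circleMap _ _)).intervalIntegrable _ _
      have hi1' : CircleIntegrable (fun x : ℂ => (2 + η) * Real.log ‖x‖) y ρ :=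
        hi1.const_fun_smul (a := 2 + η)
      have hi2' : CircleIntegrable (fun x : ℂ => (-δ) * ‖x‖ ^ 2) y ρ :=
        hi2.const_fun_smul (a := -δ)
      have hi3 : CircleIntegrable (fun x : ℂ =>
          (c - η * Real.log r + δ * R ^ 2 + M) + (-δ) * ‖x‖ ^ 2) y ρ :=
        (circleIntegrable_const _ _ _).add hi2'
      have havg := (hs.le_circleAverage y ρ hρ).trans
        (Real.circleAverage_mono (hs.circleIntegrable y ρ hρ) (CircleIntegrable.fun_add hi1' hi3) hle)
      have e1 := Real.circleAverage_fun_smul (a := 2 + η) (f := fun x : ℂ => Real.log ‖x‖)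
        (c := y) (R := ρ)
      have e2 := Real.circleAverage_fun_smul (a := -δ) (f := fun x : ℂ => ‖x‖ ^ 2)
        (c := y) (R := ρ)
      simp only [smul_eq_mul] at e1 e2
      rw [Real.circleAverage_fun_add hi1' hi3,
        Real.circleAverage_fun_add (circleIntegrable_const _ _ _) hi2', e1, e2,
        Real.circleAverage_const, circleAverage_norm_sq,
        circleAverage_log_norm_of_le hρ (by linarith)] at havg
      have : 0 < δ * ρ ^ 2 := by positivity
      simp only [hM, hv] at havg
      linarith
    have hlim0 : Tendsto (fun δ : ℝ => s z - v z + δ * (‖z‖ ^ 2 - R ^ 2)) (𝓝[>] 0)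
        (𝓝 (s z - v z + 0 * (‖z‖ ^ 2 - R ^ 2))) := by
      refine Tendsto.mono_left (Continuous.tendsto ?_ 0) nhdsWithin_le_nhds
      fun_prop
    have h := le_of_tendsto hlim0 (by filter_upwards [self_mem_nhdsWithin] with δ h using hδ δ h)
    have hz0 : 0 < ‖z‖ := hr.trans_le hz
    rw [Real.log_div hz0.ne' hr.ne']
    simp only [hv] at h
    linarith
  have hlim0 : Tendsto (fun η : ℝ => 2 * Real.log ‖z‖ + c + η * Real.log (‖z‖ / r)) (𝓝[>] 0)
      (𝓝 (2 * Real.log ‖z‖ + c + 0 * Real.log (‖z‖ / r))) := by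
    refine Tendsto.mono_left (Continuous.tendsto ?_ 0) nhdsWithin_le_nhds
    fun_prop
  have h := ge_of_tendsto hlim0 (by filter_upwards [self_mem_nhdsWithin] with η h using step η h)
  linarith

end Subharmonic

/-! ### The obstacle problem -/

section Obstacle

/-- The potential along the positive real axis. -/
def radialPotential (Q : ℂ → EReal) (r : ℝ) : ℝ := (Q (r : ℂ)).toReal

variable {Q : ℂ → EReal}

namespace IsAdmissible

/-- The function is upper semicontinuous, vanishes at `0` because `l > 0`, and falls below its value
at `p` far out because `l ≤ 2 < 2a`. So the maximum over a large interval is global and attained at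
a positive radius. -/
lemma exists_max_rpow_mul_boltzmann (hQ : IsAdmissible Q) {l : ℝ} (hl : 0 < l) (hl2 : l ≤ 2)
    {p : ℝ} (hp : 0 < p) (hwp : 0 < boltzmann Q p) :
    ∃ r : ℝ, 0 < r ∧ 0 < r ^ l * boltzmann Q r ∧
      ∀ x : ℝ, 0 ≤ x → x ^ l * boltzmann Q x ≤ r ^ l * boltzmann Q r := by
  obtain ⟨a, ha, R, hR, h⟩ := hQ.exists_boltzmann_le_rpow
  have hFp : 0 < p ^ l * boltzmann Q p := mul_pos (Real.rpow_pos_of_pos hp l) hwp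
  have hlim : Tendsto (fun x : ℝ => x ^ (-(2 * a - 2))) atTop (𝓝 0) :=
    tendsto_rpow_neg_atTop (by linarith)
  obtain ⟨T, hT⟩ := eventually_atTop.1 (hlim.eventually_lt_const hFp)
  set S : ℝ := max (max R T) p with hS
  have hfar : ∀ x, S ≤ x → x ^ l * boltzmann Q x ≤ p ^ l * boltzmann Q p := by
    intro x hx
    have hxR : R ≤ x := (le_max_left _ _).trans ((le_max_left _ _).trans hx)
    have hxT : T ≤ x := (le_max_right _ _).trans ((le_max_left _ _).trans hx)
    have hx1 : 1 ≤ x := hR.le.trans hxR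
    have hx0 : 0 < x := by linarith
    have h1 : boltzmann Q x ≤ x ^ (-(2 * a)) := by
      have := h (x : ℂ) (by simpa [abs_of_pos hx0] using hxR)
      simpa [abs_of_pos hx0] using this
    calc x ^ l * boltzmann Q x ≤ x ^ (2 : ℝ) * x ^ (-(2 * a)) := by
          apply mul_le_mul (Real.rpow_le_rpow_of_exponent_le hx1 hl2) h1 (boltzmann_nonneg _)
          positivity
      _ = x ^ (-(2 * a - 2)) := by rw [← Real.rpow_add hx0]; congr 1; ring
      _ ≤ _ := (hT x hxT).le
  have hpS : p ≤ S := le_max_right _ _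
  have husc : UpperSemicontinuousOn (fun x : ℝ => x ^ l * boltzmann Q x) (Set.Icc 0 S) := by
    refine upperSemicontinuousOn_mul (Real.continuous_rpow_const hl.le).continuousOn
      (fun x hx => Real.rpow_nonneg hx.1 l) ?_
    exact (hQ.upperSemicontinuous_boltzmann.comp Complex.continuous_ofReal).upperSemicontinuousOn _
  obtain ⟨r, hr, hmax⟩ := husc.exists_isMaxOn
    (Set.nonempty_of_mem (show p ∈ Set.Icc 0 S from ⟨hp.le, hpS⟩)) isCompact_Icc
  have hpr := hmax (show p ∈ Set.Icc 0 S from ⟨hp.le, hpS⟩)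
  simp only [Set.mem_ofPred_eq] at hpr
  have hFr := hFp.trans_le hpr
  refine ⟨r, ?_, hFr, fun x hx => ?_⟩
  · refine hr.1.lt_of_ne fun h0 => ?_
    rw [← h0, Real.zero_rpow hl.ne', zero_mul] at hFr
    exact lt_irrefl _ hFr
  · rcases le_total x S with hxS | hxS
    · exact hmax (show x ∈ Set.Icc 0 S from ⟨hx, hxS⟩)
    · exact (hfar x hxS).trans hpr

end IsAdmissible

lemma obstacle_le (z : ℂ) : obstacle Q z ≤ Q z :=
  iSup₂_le fun _ hs => hs.le_potential z

namespace IsAdmissible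

lemma boltzmann_radial (hQ : IsAdmissible Q) (z : ℂ) :
    boltzmann Q z = boltzmann Q ((‖z‖ : ℝ) : ℂ) := (hQ.boltzmann_norm z).symm

/-- The function `max (l log |z| - log A, B)`, with `B` a lower bound of `Q`, is a competitor:
maximality puts it below `Q`, and `l ≤ 2` gives the growth condition. At radius `r` its logarithmic
branch equals `Q`, which forces the obstacle function to equal `Q` there. -/
lemma mem_coincidenceSet_of_max (hQ : IsAdmissible Q) {l : ℝ} (hl : 0 < l) (hl2 : l ≤ 2)
    {r : ℝ} (hr : 0 < r) (hpos : 0 < r ^ l * boltzmann Q r)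
    (hmax : ∀ x : ℝ, 0 ≤ x → x ^ l * boltzmann Q x ≤ r ^ l * boltzmann Q r) :
    (r : ℂ) ∈ coincidenceSet Q := by
  obtain ⟨C, hC, hCw⟩ := hQ.exists_boltzmann_le
  set A := r ^ l * boltzmann Q r with hA
  set B : ℝ := -Real.log C with hB
  -- The radius at which the constant branch `B` meets the branch `l log |z| - log A`.
  set κ : ℝ := Real.exp ((B + Real.log A) / l) with hκ
  have hκ0 : 0 < κ := Real.exp_pos _
  have hlκ : l * Real.log κ = B + Real.log A := by
    rw [hκ, Real.log_exp]
    field_simp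
  set s : ℂ → ℝ := fun z => l * Real.posLog (‖z‖ / κ) + B with hs
  have hlog : ∀ z : ℂ, 0 < ‖z‖ → l * Real.log (‖z‖ / κ) + B = l * Real.log ‖z‖ - Real.log A := by
    intro z hz
    rw [Real.log_div hz.ne' hκ0.ne', mul_sub, hlκ]
    ring
  have hcomp : IsObstacleCompetitor Q s := by
    refine ⟨isSubharmonic_posLog hl.le hκ0 B, fun z => ?_, ?_⟩
    · rcases le_total ‖z‖ κ with hz | hz
      · have : Real.posLog (‖z‖ / κ) = 0 := by
          rw [Real.posLog_eq_zero_iff, abs_of_nonneg (by positivity)]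
          exact (div_le_one hκ0).2 hz
        simp only [hs, this, mul_zero, zero_add]
        exact (hQ.boltzmann_le_iff hC).1 (hCw z)
      · have hz0 : 0 < ‖z‖ := hκ0.trans_le hz
        have : Real.posLog (‖z‖ / κ) = Real.log (‖z‖ / κ) := by
          refine Real.posLog_eq_log ?_
          rw [abs_of_nonneg (by positivity)]
          exact (one_le_div hκ0).2 hz
        simp only [hs, this]
        rw [hlog z hz0]
        have hzl : 0 < ‖z‖ ^ l := Real.rpow_pos_of_pos hz0 l
        have h1 : boltzmann Q z ≤ A / ‖z‖ ^ l := by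
          rw [le_div_iff₀ hzl, mul_comm, hQ.boltzmann_radial z]
          exact hmax _ (norm_nonneg z)
        have h2 := (hQ.boltzmann_le_iff (by positivity)).1 h1
        rw [Real.log_div hpos.ne' hzl.ne', Real.log_rpow hz0] at h2
        simpa using h2
    · refine ⟨-Real.log A, ?_⟩
      rw [← Metric.cobounded_eq_cocompact, ← comap_norm_atTop, eventually_comap]
      filter_upwards [eventually_ge_atTop κ, eventually_ge_atTop 1] with x hx hx1 z hz
      have hz0 : 0 < ‖z‖ := by linarith
      have : Real.posLog (‖z‖ / κ) = Real.log (‖z‖ / κ) := by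
        refine Real.posLog_eq_log ?_
        rw [abs_of_nonneg (by positivity), hz]
        exact (one_le_div hκ0).2 hx
      simp only [hs, this]
      rw [hlog z hz0]
      have := mul_le_mul_of_nonneg_right hl2 (Real.log_nonneg (hz ▸ hx1 : 1 ≤ ‖z‖))
      linarith
  have hwr : 0 < boltzmann Q r := pos_of_mul_pos_right hpos (Real.rpow_nonneg hr.le l)
  have hQr : Q r ≤ ((s r : ℝ) : EReal) := by
    have h1 := (hQ.le_boltzmann_iff hwr).1 le_rfl
    refine h1.trans (EReal.coe_le_coe_iff.2 ?_)
    have h2 := hlog (r : ℂ) (by simpa using hr.ne')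
    have h3 : Real.log (‖(r : ℂ)‖ / κ) ≤ Real.posLog (‖(r : ℂ)‖ / κ) := le_max_right _ _
    have h4 : Real.log A = l * Real.log r + Real.log (boltzmann Q r) := by
      rw [hA, Real.log_mul (Real.rpow_pos_of_pos hr l).ne' hwr.ne', Real.log_rpow hr]
    have h5 : ‖(r : ℂ)‖ = r := by simp [abs_of_pos hr]
    have h6 := mul_le_mul_of_nonneg_left h3 hl.le
    simp only [hs]
    rw [h5] at h2 h6 ⊢
    linarith
  exact le_antisymm (hQr.trans (le_iSup₂_of_le s hcomp le_rfl)) (obstacle_le _)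

/-- Each competitor is at most `Q(r₁) = 2 log r₁ - log A` on the circle of radius `r₁`, hence at
most `2 log |z| - log A` outside it by the maximum principle at infinity. The supremum inherits the
bound, and it equals `Q` at `r`. -/
lemma le_sq_mul_boltzmann_of_mem_coincidenceSet (hQ : IsAdmissible Q) {r₁ r : ℝ} (hr₁ : 0 < r₁)
    (hw : 0 < boltzmann Q r₁) (hr : r₁ ≤ r) (hmem : (r : ℂ) ∈ coincidenceSet Q) :
    r₁ ^ 2 * boltzmann Q r₁ ≤ r ^ 2 * boltzmann Q r := by
  have hr0 : 0 < r := hr₁.trans_le hr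
  set A := r₁ ^ 2 * boltzmann Q r₁ with hA
  have hA0 : 0 < A := by positivity
  have hlogA : Real.log A = 2 * Real.log r₁ + Real.log (boltzmann Q r₁) := by
    rw [hA, Real.log_mul (by positivity) hw.ne', Real.log_pow]
    norm_num
  have hob : Q r ≤ ((2 * Real.log r - Real.log A : ℝ) : EReal) := by
    rw [show Q r = obstacle Q r from hmem]
    refine iSup₂_le fun s hs => EReal.coe_le_coe_iff.2 ?_
    have hn : ‖(r : ℂ)‖ = r := by simp [abs_of_pos hr0]
    have := hs.isSubharmonic.le_log_of_growth hs.growth (c := -Real.log A) hr₁ ?_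
      (z := (r : ℂ)) (by rw [hn]; exact hr)
    · rw [hn] at this
      linarith
    · intro z hz
      have h1 := hs.le_potential z
      have h2 : boltzmann Q z = boltzmann Q r₁ := by rw [hQ.boltzmann_radial z, hz]
      have h3 := h1.trans ((hQ.le_boltzmann_iff hw).1 h2.ge)
      have h4 := EReal.coe_le_coe_iff.1 h3
      linarith
  have h1 : A / r ^ 2 ≤ boltzmann Q r := by
    rw [hQ.le_boltzmann_iff (by positivity), Real.log_div hA0.ne' (by positivity), Real.log_pow]
    simpa using hob
  rwa [div_le_iff₀ (by positivity), mul_comm] at h1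

lemma contDiffAt_of_mem_coincidenceSet (hQ : IsAdmissible Q) {z : ℂ}
    (hz : z ∈ coincidenceSet Q) :
    ContDiffAt ℝ 2 (fun w => (Q w).toReal) z ∧ ∀ᶠ w in 𝓝 z, Q w ≠ ⊤ := by
  obtain ⟨U, hU, hSU, htop, hsm⟩ := hQ.smooth
  have hUz := hU.mem_nhds (hSU hz)
  exact ⟨(hsm.contDiffAt hUz).of_le (by norm_num), by filter_upwards [hUz] with w hw using htop w hw⟩

lemma radialPotential_props (hQ : IsAdmissible Q) {r : ℝ} (hr : 0 < r)
    (hmem : (r : ℂ) ∈ coincidenceSet Q) :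
    (∀ᶠ x in 𝓝 r, DifferentiableAt ℝ (radialPotential Q) x) ∧
    DifferentiableAt ℝ (deriv (radialPotential Q)) r ∧
    (∀ᶠ x : ℝ in 𝓝 r, boltzmann Q x = Real.exp (-radialPotential Q x)) ∧
    4 * quarterLaplacian Q r = deriv (deriv (radialPotential Q)) r +
      deriv (radialPotential Q) r / r := by
  obtain ⟨hC, htop⟩ := hQ.contDiffAt_of_mem_coincidenceSet hmem
  have hgC : ContDiffAt ℝ 2 (radialPotential Q) r :=
    hC.comp r (Complex.ofRealCLM.contDiff.contDiffAt)
  refine ⟨?_, ?_, ?_, ?_⟩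
  · filter_upwards [hgC.eventually (by simp)] with z hz using hz.differentiableAt (by norm_num)
  · have h1 : DifferentiableAt ℝ (fderiv ℝ (radialPotential Q)) r :=
      (hgC.fderiv_right (m := 1) (by norm_num)).differentiableAt (by norm_num)
    have h2 : deriv (radialPotential Q) = fun x => fderiv ℝ (radialPotential Q) x 1 := by
      ext x
      exact fderiv_apply_one_eq_deriv.symm
    rw [h2]
    exact h1.clm_apply (differentiableAt_const 1)
  · filter_upwards [Complex.continuous_ofReal.continuousAt.eventually htop] with x hx
    exact hQ.boltzmann_eq_exp hx
  · have hrad : ∀ z, (Q z).toReal = (Q (‖z‖ : ℂ)).toReal := fun z => by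
      rw [hQ.rotation_invariant z (‖z‖ : ℂ) (by simp)]
    rw [quarterLaplacian, laplacian_radial hrad hr hC, ← mul_assoc]
    norm_num
    rfl

/-- A maximum of `x^l e^{-Q(x)}` at a point of the coincidence set is a critical point. -/
lemma deriv_radialPotential_of_max (hQ : IsAdmissible Q) {l r : ℝ} (hr : 0 < r)
    (hmem : (r : ℂ) ∈ coincidenceSet Q)
    (hmax : ∀ᶠ x : ℝ in 𝓝 r, x ^ l * boltzmann Q x ≤ r ^ l * boltzmann Q r) :
    deriv (radialPotential Q) r = l / r := by
  obtain ⟨hd, -, hexp, -⟩ := hQ.radialPotential_props hr hmem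
  have hmin : IsLocalMin (fun x => radialPotential Q x - l * Real.log x) r := by
    filter_upwards [hexp, hmax, lt_mem_nhds hr] with x hx hxm hx0
    rw [hx, hexp.self_of_nhds, Real.rpow_def_of_pos hx0, Real.rpow_def_of_pos hr, ← Real.exp_add,
      ← Real.exp_add, Real.exp_le_exp] at hxm
    linarith
  have h1 := (hd.self_of_nhds.hasDerivAt.sub ((Real.hasDerivAt_log hr.ne').const_mul l))
  have h2 := hmin.hasDerivAt_eq_zero h1
  rw [div_eq_mul_inv]
  linarith

end IsAdmissible

lemma ofReal_mem_coincidenceSet_iff {m : ℕ} {a₀ b₀ : ℝ} {t : Fin m → ℝ}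
    (hS : HasOuterOutposts Q a₀ b₀ t) {r : ℝ} (hr : 0 ≤ r) :
    (r : ℂ) ∈ coincidenceSet Q ↔ (a₀ ≤ r ∧ r ≤ b₀) ∨ ∃ k, r = t k := by
  rw [hS.coincidenceSet_eq]
  simp [annulus, abs_of_nonneg hr]

/-- The maximum of `r² e^{-Q(r)}` is attained exactly at the outer boundary of the droplet and at the
outposts. -/
lemma exists_max_sq_mul_boltzmann (hQ : IsAdmissible Q) {m : ℕ} {a₀ b₀ : ℝ} {t : Fin m → ℝ}
    (hS : HasOuterOutposts Q a₀ b₀ t) (hb : 0 < quarterLaplacian Q (b₀ : ℂ)) :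
    ∃ A : ℝ, 0 < A ∧ (∀ x : ℝ, 0 ≤ x → x ^ 2 * boltzmann Q x ≤ A) ∧
      ∀ x : ℝ, 0 ≤ x → (x ^ 2 * boltzmann Q x = A ↔ x = b₀ ∨ ∃ k, x = t k) := by
  have hb0 : 0 < b₀ := hS.nonneg.trans_lt hS.lt
  have hbm : (b₀ : ℂ) ∈ coincidenceSet Q :=
    (ofReal_mem_coincidenceSet_iff hS hb0.le).2 (Or.inl ⟨hS.lt.le, le_rfl⟩)
  have hwb : 0 < boltzmann Q b₀ := by
    rw [(hQ.radialPotential_props hb0 hbm).2.2.1.self_of_nhds]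
    exact Real.exp_pos _
  obtain ⟨C, hC, hCw⟩ := hQ.exists_boltzmann_le
  -- the maximum over `[0, b₀]`
  have husc : UpperSemicontinuousOn (fun x : ℝ => x ^ 2 * boltzmann Q x) (Set.Icc 0 b₀) := by
    refine upperSemicontinuousOn_mul (continuous_pow 2).continuousOn
      (fun x _ => sq_nonneg x) ?_
    exact (hQ.upperSemicontinuous_boltzmann.comp Complex.continuous_ofReal).upperSemicontinuousOn _
  obtain ⟨r₁, hr₁, hmax₁⟩ := husc.exists_isMaxOn
    (Set.nonempty_of_mem (show b₀ ∈ Set.Icc 0 b₀ from ⟨hb0.le, le_rfl⟩)) isCompact_Icc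
  set A := r₁ ^ 2 * boltzmann Q r₁ with hA
  have hA0 : 0 < A := by
    have h1 : b₀ ^ 2 * boltzmann Q b₀ ≤ A := hmax₁ (show b₀ ∈ Set.Icc 0 b₀ from ⟨hb0.le, le_rfl⟩)
    exact lt_of_lt_of_le (by positivity) h1
  have hr₁0 : 0 < r₁ := by
    refine hr₁.1.lt_of_ne fun h => ?_
    rw [hA, ← h] at hA0
    simp at hA0
  have hw₁ : 0 < boltzmann Q r₁ := pos_of_mul_pos_right hA0 (sq_nonneg _)
  -- it is the global maximum
  have hglob : ∀ x : ℝ, 0 ≤ x → x ^ 2 * boltzmann Q x ≤ A := by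
    intro x hx
    rcases hx.eq_or_lt with rfl | hx0
    · simpa using hA0.le
    -- A maximizer `r` of `x^l e^{-Q}` satisfies `r Q'(r) = l`. Avoiding the finitely many values
    -- `t_k Q'(t_k)` keeps it off the outposts, hence in `(0, b₀]`.
    set bad : Set ℝ := Set.range fun k => t k * deriv (radialPotential Q) (t k) with hbad
    have hfin : bad.Finite := Set.finite_range _
    have hgood : ∀ᶠ l in 𝓝[<] (2 : ℝ), l ∉ bad := by
      -- The value `2` may itself be bad; it is removed, since only `l < 2` matters.
      have h1 : (bad \ {2})ᶜ ∈ 𝓝 (2 : ℝ) :=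
        (hfin.subset Set.sdiff_subset).isClosed.isOpen_compl.mem_nhds (by simp)
      filter_upwards [mem_nhdsWithin_of_mem_nhds h1, self_mem_nhdsWithin] with l hl hl2 hmem
      exact hl ⟨hmem, ne_of_lt hl2⟩
    have hpos : ∀ᶠ l in 𝓝[<] (2 : ℝ), 0 < l :=
      mem_nhdsWithin_of_mem_nhds (lt_mem_nhds (by norm_num))
    have hbound : ∀ᶠ l in 𝓝[<] (2 : ℝ),
        x ^ l * boltzmann Q x ≤ A ^ (l / 2) * C ^ (1 - l / 2) := by
      filter_upwards [hgood, hpos, self_mem_nhdsWithin] with l hlbad hl0 hl2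
      have hl2' : l < 2 := hl2
      obtain ⟨r, hr, hrpos, hrmax⟩ :=
        hQ.exists_max_rpow_mul_boltzmann hl0 hl2'.le hb0 hwb
      have hmem := hQ.mem_coincidenceSet_of_max hl0 hl2'.le hr hrpos hrmax
      have hcrit := hQ.deriv_radialPotential_of_max hr hmem
        (by filter_upwards [lt_mem_nhds hr] with y hy using hrmax y hy.le)
      have hrb : r ≤ b₀ := by
        rcases (ofReal_mem_coincidenceSet_iff hS hr.le).1 hmem with h | ⟨k, hk⟩
        · exact h.2
        · exfalso
          refine hlbad ⟨k, ?_⟩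
          simp only
          rw [← hk, hcrit]
          field_simp
      refine (hrmax x hx).trans ?_
      have hwr : 0 ≤ boltzmann Q r := boltzmann_nonneg _
      have hF : r ^ 2 * boltzmann Q r ≤ A := hmax₁ (show r ∈ Set.Icc 0 b₀ from ⟨hr.le, hrb⟩)
      have hwr0 : 0 < boltzmann Q r := pos_of_mul_pos_right hrpos (Real.rpow_nonneg hr.le l)
      -- The maximizer `r` depends on `l` without control. Interpolating between `r² e^{-Q} ≤ A` and
      -- `e^{-Q} ≤ C` gives a bound free of `r` that tends to `A` as `l → 2`.
      calc r ^ l * boltzmann Q r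
          = (r ^ 2 * boltzmann Q r) ^ (l / 2) * boltzmann Q r ^ (1 - l / 2) := by
            rw [Real.mul_rpow (by positivity) hwr, mul_assoc, ← Real.rpow_add hwr0,
              ← Real.rpow_natCast r 2, ← Real.rpow_mul hr.le]
            have e1 : ((2 : ℕ) : ℝ) * (l / 2) = l := by push_cast; ring
            have e2 : l / 2 + (1 - l / 2) = 1 := by ring
            rw [e1, e2, Real.rpow_one]
        _ ≤ A ^ (l / 2) * C ^ (1 - l / 2) := by
            apply mul_le_mul (Real.rpow_le_rpow (by positivity) hF (by linarith))
              (Real.rpow_le_rpow hwr (hCw _) (by linarith)) (by positivity) (by positivity)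
    have hl1 : Tendsto (fun l : ℝ => x ^ l * boltzmann Q x) (𝓝[<] 2)
        (𝓝 (x ^ (2 : ℝ) * boltzmann Q x)) := by
      refine Tendsto.mono_left ?_ nhdsWithin_le_nhds
      exact ((Real.continuousAt_const_rpow hx0.ne').tendsto).mul_const _
    have hl2 : Tendsto (fun l : ℝ => A ^ (l / 2) * C ^ (1 - l / 2)) (𝓝[<] 2)
        (𝓝 (A ^ ((2 : ℝ) / 2) * C ^ (1 - (2 : ℝ) / 2))) := by
      refine Tendsto.mono_left ?_ nhdsWithin_le_nhds
      refine Continuous.tendsto (f := fun l : ℝ => A ^ (l / 2) * C ^ (1 - l / 2)) ?_ 2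
      exact ((Real.continuous_const_rpow hA0.ne').comp (by fun_prop)).mul
        ((Real.continuous_const_rpow hC.ne').comp (by fun_prop))
    have := le_of_tendsto_of_tendsto hl1 hl2 hbound
    simpa using this
  refine ⟨A, hA0, hglob, ?_⟩
  -- the coincidence set beyond a maximizer consists of maximizers
  have hbeyond : ∀ r x : ℝ, 0 < r → r ^ 2 * boltzmann Q r = A → r ≤ x →
      (x : ℂ) ∈ coincidenceSet Q → x ^ 2 * boltzmann Q x = A := by
    intro r x hr hrA hrx hmem
    have hw : 0 < boltzmann Q r := by
      rw [← hrA] at hA0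
      exact pos_of_mul_pos_right hA0 (sq_nonneg _)
    refine le_antisymm (hglob x (hr.le.trans hrx)) ?_
    rw [← hrA]
    exact hQ.le_sq_mul_boltzmann_of_mem_coincidenceSet hr hw hrx hmem
  intro x hx
  constructor
  · intro hxA
    have hx0 : 0 < x := by
      refine hx.lt_of_ne fun h => ?_
      rw [← hxA, ← h] at hA0
      simp at hA0
    have hmem : (x : ℂ) ∈ coincidenceSet Q := by
      refine hQ.mem_coincidenceSet_of_max two_pos le_rfl hx0 ?_ fun y hy => ?_
      · simpa [hxA] using hA0
      · have := hglob y hy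
        rw [← hxA] at this
        simpa using this
    rcases (ofReal_mem_coincidenceSet_iff hS hx).1 hmem with h | h
    · left
      -- If `x < b₀` were a maximizer, all of `[x, b₀]` would consist of maximizers. Then `Q' = 2/r`
      -- to the left of `b₀`, which determines `Q''(b₀)` because `Q` is smooth there, and `ΔQ(b₀)`
      -- would vanish.
      by_contra hne
      have hlt : x < b₀ := lt_of_le_of_ne h.2 hne
      obtain ⟨hd, hd2, hexp, hlap⟩ := hQ.radialPotential_props hb0 hbm
      have hev : ∀ᶠ y in 𝓝[<] b₀, deriv (radialPotential Q) y = 2 / y := by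
        have h1 : Set.Ioo x b₀ ∈ 𝓝[<] b₀ := Ioo_mem_nhdsLT hlt
        filter_upwards [h1] with y hy
        have hy0 : 0 < y := hx0.trans hy.1
        have hym : (y : ℂ) ∈ coincidenceSet Q :=
          (ofReal_mem_coincidenceSet_iff hS hy0.le).2 (Or.inl ⟨h.1.trans hy.1.le, hy.2.le⟩)
        have hyA := hbeyond x y hx0 hxA hy.1.le hym
        refine hQ.deriv_radialPotential_of_max hy0 hym ?_
        filter_upwards [lt_mem_nhds hy0] with u hu
        have := hglob u hu.le
        rw [← hyA] at this
        simpa using this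
      have hbA := hbeyond x b₀ hx0 hxA hlt.le hbm
      have hb1 : deriv (radialPotential Q) b₀ = 2 / b₀ := by
        refine hQ.deriv_radialPotential_of_max hb0 hbm ?_
        filter_upwards [lt_mem_nhds hb0] with u hu
        have := hglob u hu.le
        rw [← hbA] at this
        simpa using this
      have hdw : HasDerivWithinAt (fun y : ℝ => 2 / y) (deriv (deriv (radialPotential Q)) b₀)
          (Set.Iio b₀) b₀ :=
        (hd2.hasDerivAt.hasDerivWithinAt (s := Set.Iio b₀)).congr_of_eventuallyEq
          (by filter_upwards [hev] with y hy using hy.symm) hb1.symm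
      have hdw2 : HasDerivWithinAt (fun y : ℝ => 2 / y) (-2 / b₀ ^ 2) (Set.Iio b₀) b₀ := by
        have := (hasDerivAt_inv hb0.ne').const_mul (2 : ℝ)
        have e : (2 : ℝ) * -(b₀ ^ 2)⁻¹ = -2 / b₀ ^ 2 := by ring
        rw [e] at this
        simpa [div_eq_mul_inv] using this.hasDerivWithinAt
      have huniq := (uniqueDiffWithinAt_Iio b₀).eq_deriv _ hdw hdw2
      rw [huniq, hb1] at hlap
      have : (-2 / b₀ ^ 2 + 2 / b₀ / b₀ : ℝ) = 0 := by
        field_simp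
        ring
      linarith
    · exact Or.inr h
  · rintro (rfl | ⟨k, rfl⟩)
    · exact hbeyond r₁ _ hr₁0 rfl hr₁.2 hbm
    · refine hbeyond r₁ _ hr₁0 rfl (hr₁.2.trans (hS.lt_outpost k).le) ?_
      exact (ofReal_mem_coincidenceSet_iff hS hx).2 (Or.inr ⟨k, rfl⟩)

/-- The expansion of the effective potential at a maximizer of `r² e^{-Q(r)}`. -/
lemma IsAdmissible.exists_expansion (hQ : IsAdmissible Q) {A s : ℝ} (hA : 0 < A) (hs : 0 < s)
    (hmem : (s : ℂ) ∈ coincidenceSet Q) (hmax : ∀ x : ℝ, 0 ≤ x → x ^ 2 * boltzmann Q x ≤ A)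
    (hsA : s ^ 2 * boltzmann Q s = A) :
    ∃ u : ℝ → ℝ, (∀ᶠ x : ℝ in 𝓝 s, x ^ 2 * boltzmann Q x / A = Real.exp (-u x)) ∧
      (fun x => u x - (4 * quarterLaplacian Q s) / 2 * (x - s) ^ 2) =o[𝓝 s]
        fun x => (x - s) ^ 2 := by
  obtain ⟨hd, hd2, hexp, hlap⟩ := hQ.radialPotential_props hs hmem
  have hcrit : deriv (radialPotential Q) s = 2 / s := by
    refine hQ.deriv_radialPotential_of_max hs hmem ?_
    filter_upwards [lt_mem_nhds hs] with x hx
    have := hmax x hx.le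
    rw [← hsA] at this
    simpa using this
  set u : ℝ → ℝ := fun x => radialPotential Q x - 2 * Real.log x + Real.log A with hu
  have hev : ∀ᶠ x : ℝ in 𝓝 s, x ^ 2 * boltzmann Q x / A = Real.exp (-u x) := by
    filter_upwards [hexp, lt_mem_nhds hs] with x hx hx0
    have : -u x = 2 * Real.log x + -radialPotential Q x - Real.log A := by simp only [hu]; ring
    rw [this, Real.exp_sub, Real.exp_add, Real.exp_log hA, hx]
    congr 2
    rw [show (2 : ℝ) * Real.log x = Real.log (x ^ 2) by rw [Real.log_pow]; norm_num,
      Real.exp_log (by positivity)]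
  have hdu : ∀ᶠ x in 𝓝 s, HasDerivAt u (deriv (radialPotential Q) x - 2 * x⁻¹) x := by
    filter_upwards [hd, lt_mem_nhds hs] with x hx hx0
    exact (hx.hasDerivAt.sub ((Real.hasDerivAt_log hx0.ne').const_mul 2)).add_const _
  refine ⟨u, hev, isLittleO_sub_quadratic ?_ ?_ ?_ ?_⟩
  · filter_upwards [hdu] with x hx using hx.differentiableAt
  · have h1 := hev.self_of_nhds
    rw [hsA, div_self hA.ne'] at h1
    have := Real.exp_eq_one_iff (-u s)
    linarith [this.1 h1.symm]
  · rw [hdu.self_of_nhds.deriv, hcrit]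
    ring
  · have h1 : HasDerivAt (fun x => deriv (radialPotential Q) x - 2 * x⁻¹)
        (deriv (deriv (radialPotential Q)) s - 2 * -(s ^ 2)⁻¹) s :=
      hd2.hasDerivAt.sub ((hasDerivAt_inv hs.ne').const_mul 2)
    -- Since `Q'(s) = 2/s`, the second derivative `Q'' + 2/s²` of the effective potential is `Q'' +
    -- Q'/s`, the polar form of the full Laplacian.
    have h2 : 4 * quarterLaplacian Q s = deriv (deriv (radialPotential Q)) s - 2 * -(s ^ 2)⁻¹ := by
      rw [hlap, hcrit]
      field_simp
      ring
    rw [h2]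
    refine h1.congr_of_eventuallyEq ?_
    filter_upwards [hdu] with x hx using hx.deriv

end Obstacle

/-! ### Laplace's method -/

section LaplaceMethod

/-- Laplace's method near a nondegenerate maximum. -/
lemma tendsto_laplace_local {E g u : ℝ → ℝ} (hEm : Measurable E) (hgm : Measurable g) {s κ : ℝ}
    (hκ : 0 < κ) (hg : ContinuousAt g s) (hE : ∀ᶠ x in 𝓝 s, E x = Real.exp (-u x))
    (hu : (fun x => u x - κ / 2 * (x - s) ^ 2) =o[𝓝 s] fun x => (x - s) ^ 2) :
    ∀ᶠ δ : ℝ in 𝓝[>] 0, Tendsto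
      (fun n : ℕ => Real.sqrt n * ∫ x in Set.Ioo (s - δ) (s + δ), g x * E x ^ n) atTop
      (𝓝 (g s * Real.sqrt (2 * Real.pi / κ))) := by
  -- An error of at most `κ/4 (x - s)²` leaves `u ≥ κ/4 (x - s)²`, the Gaussian majorant after
  -- rescaling.
  have hquad := hu.def (show (0 : ℝ) < κ / 4 by positivity)
  have hbd : ∀ᶠ x in 𝓝 s, |g x| < |g s| + 1 :=
    (continuous_abs.continuousAt.comp hg).eventually_lt_const (by simp)
  obtain ⟨δ₀, hδ₀, hball⟩ := Metric.eventually_nhds_iff_ball.1 (hquad.and (hbd.and hE))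
  -- The limit is independent of `δ`; every small `δ` is allowed so that several maxima can share
  -- one.
  filter_upwards [Ioo_mem_nhdsGT hδ₀] with δ hδ
  have hin : ∀ x ∈ Set.Ioo (s - δ) (s + δ), x ∈ Metric.ball s δ₀ := by
    intro x hx
    rw [Real.ball_eq_Ioo]
    exact ⟨by linarith [hx.1, hδ.2], by linarith [hx.2, hδ.2]⟩
  set I := Set.Ioo (s - δ) (s + δ) with hI
  set F : ℕ → ℝ → ℝ := fun n => I.indicator fun x => g x * E x ^ n with hF
  have hFm : ∀ n, Measurable (F n) := fun n =>
    (hgm.mul (hEm.pow_const n)).indicator measurableSet_Ioo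
  -- Substitution `x = s + y / √n`.
  have hscale : ∀ n : ℕ, Real.sqrt n * ∫ x in I, g x * E x ^ n =
      ∫ y, F n (s + y / Real.sqrt n) := by
    intro n
    rw [Measure.integral_comp_div (fun x => F n (s + x)) (Real.sqrt n),
      integral_add_left_eq_self (F n) s, abs_of_nonneg (Real.sqrt_nonneg _), smul_eq_mul,
      hF, integral_indicator measurableSet_Ioo]
  have hsq : ∀ (n : ℕ), 1 ≤ n → ∀ y : ℝ, (n : ℝ) * (s + y / Real.sqrt n - s) ^ 2 = y ^ 2 := by
    intro n hn y
    have hn0 : (0 : ℝ) < n := by exact_mod_cast hn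
    rw [add_sub_cancel_left, div_pow, Real.sq_sqrt hn0.le]
    field_simp
  have hlimx : ∀ y : ℝ, Tendsto (fun n : ℕ => s + y / Real.sqrt n) atTop (𝓝 s) := by
    intro y
    have h1 : Tendsto (fun n : ℕ => Real.sqrt n) atTop atTop :=
      Real.tendsto_sqrt_atTop.comp tendsto_natCast_atTop_atTop
    simpa using (h1.const_div_atTop y).const_add s
  have hgauss : ∫ y : ℝ, g s * Real.exp (-(κ / 2) * y ^ 2) =
      g s * Real.sqrt (2 * Real.pi / κ) := by
    rw [integral_const_mul, integral_gaussian]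
    congr 2
    field_simp
  simp only [hscale]
  rw [← hgauss]
  refine tendsto_integral_filter_of_dominated_convergence
    (fun y => (|g s| + 1) * Real.exp (-(κ / 4) * y ^ 2)) ?_ ?_ ?_ ?_
  · refine Eventually.of_forall fun n => ?_
    exact ((hFm n).comp (by fun_prop)).aestronglyMeasurable
  · filter_upwards [eventually_ge_atTop 1] with n hn
    refine Eventually.of_forall fun y => ?_
    by_cases hy : s + y / Real.sqrt n ∈ I
    · obtain ⟨h1, h2, h3⟩ := hball _ (hin _ hy)
      simp only [hF, Set.indicator_of_mem hy, norm_mul, norm_pow, Real.norm_eq_abs]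
      rw [h3, abs_of_pos (Real.exp_pos _), ← Real.exp_nat_mul]
      refine mul_le_mul h2.le (Real.exp_le_exp.2 ?_) (Real.exp_pos _).le (by positivity)
      rw [Real.norm_eq_abs, Real.norm_eq_abs, abs_of_nonneg (sq_nonneg (_ - s))] at h1
      have h4 := (abs_le.1 h1).1
      have h5 : κ / 4 * (s + y / Real.sqrt n - s) ^ 2 ≤ u (s + y / Real.sqrt n) := by linarith
      have h6 := mul_le_mul_of_nonneg_left h5 (Nat.cast_nonneg (α := ℝ) n)
      have h7 := hsq n hn y
      have h8 : (n : ℝ) * (κ / 4 * (s + y / Real.sqrt n - s) ^ 2) = κ / 4 * y ^ 2 := by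
        rw [← h7]; ring
      linarith
    · simp only [hF, Set.indicator_of_notMem hy, norm_zero]
      positivity
  · exact (integrable_exp_neg_mul_sq (by positivity)).const_mul _
  · refine Eventually.of_forall fun y => ?_
    have hx := hlimx y
    have hev : ∀ᶠ n : ℕ in atTop, g (s + y / Real.sqrt n) *
        Real.exp (-(κ / 2) * y ^ 2 - n * (u (s + y / Real.sqrt n) -
          κ / 2 * (s + y / Real.sqrt n - s) ^ 2)) = F n (s + y / Real.sqrt n) := by
      have hmem : I ∈ 𝓝 s := Ioo_mem_nhds (by linarith [hδ.1]) (by linarith [hδ.1])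
      filter_upwards [hx.eventually hmem, eventually_ge_atTop 1] with n hn hn1
      have hn' : s + y / Real.sqrt n ∈ I := hn
      simp only [hF, Set.indicator_of_mem hn']
      rw [(hball _ (hin _ hn')).2.2, ← Real.exp_nat_mul, ← hsq n hn1 y]
      congr 2
      ring
    refine Tendsto.congr' hev ?_
    have hsmall : Tendsto (fun n : ℕ => (n : ℝ) * (u (s + y / Real.sqrt n) -
          κ / 2 * (s + y / Real.sqrt n - s) ^ 2)) atTop (𝓝 0) := by
      have h1 := hu.comp_tendsto hx
      have h2 := (Asymptotics.isBigO_refl (fun n : ℕ => (n : ℝ)) atTop).mul_isLittleO h1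
      have h3 : (fun n : ℕ => (n : ℝ) * ((fun x => (x - s) ^ 2) ∘ fun n : ℕ =>
          s + y / Real.sqrt n) n) =ᶠ[atTop] fun _ => y ^ 2 := by
        filter_upwards [eventually_ge_atTop 1] with n hn using hsq n hn y
      have h4 := h2.trans_eventuallyEq h3
      exact (Asymptotics.isLittleO_one_iff ℝ).1
        (h4.trans_isBigO (Asymptotics.isBigO_const_const _ one_ne_zero _))
    have hlim := (hg.tendsto.comp hx).mul
      ((Real.continuous_exp.tendsto _).comp (hsmall.const_sub (-(κ / 2) * y ^ 2)))
    simpa using hlim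

lemma integrableOn_mul_pow {E g : ℝ → ℝ} (hEm : Measurable E) (hgm : Measurable g)
    (hE0 : ∀ x, 0 ≤ E x) (hE1 : ∀ x, 0 < x → E x ≤ 1) {n₀ n : ℕ}
    (hint : IntegrableOn (fun x => g x * E x ^ n₀) (Set.Ioi 0)) (hn : n₀ ≤ n) :
    IntegrableOn (fun x => g x * E x ^ n) (Set.Ioi 0) := by
  refine Integrable.mono hint (hgm.mul (hEm.pow_const n)).aestronglyMeasurable ?_
  filter_upwards [ae_restrict_mem measurableSet_Ioi] with x hx
  rw [norm_mul, norm_mul, norm_pow, norm_pow, Real.norm_of_nonneg (hE0 x)]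
  exact mul_le_mul_of_nonneg_left (pow_le_pow_of_le_one (hE0 x) (hE1 x hx) hn) (norm_nonneg _)

/-- Laplace's method with finitely many nondegenerate maxima. -/
lemma tendsto_laplace {ι : Type*} [Fintype ι] {E g : ℝ → ℝ} (hEm : Measurable E)
    (hgm : Measurable g) (hE0 : ∀ x, 0 ≤ E x) (hE1 : ∀ x, 0 < x → E x ≤ 1) {s κ : ι → ℝ}
    (hs : Function.Injective s) (hs0 : ∀ i, 0 < s i) (hκ : ∀ i, 0 < κ i)
    (hg : ∀ i, ContinuousAt g (s i))
    (hE : ∀ i, ∃ u : ℝ → ℝ, (∀ᶠ x in 𝓝 (s i), E x = Real.exp (-u x)) ∧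
      (fun x => u x - κ i / 2 * (x - s i) ^ 2) =o[𝓝 (s i)] fun x => (x - s i) ^ 2)
    (htail : ∀ δ : ℝ, 0 < δ → ∃ θ : ℝ, 0 ≤ θ ∧ θ < 1 ∧ ∀ x : ℝ, 0 < x → (∀ i, δ ≤ |x - s i|) →
      E x ≤ θ)
    {n₀ : ℕ} (hint : IntegrableOn (fun x => g x * E x ^ n₀) (Set.Ioi 0)) :
    Tendsto (fun n : ℕ => Real.sqrt n * ∫ x in Set.Ioi 0, g x * E x ^ n) atTop
      (𝓝 (∑ i, g (s i) * Real.sqrt (2 * Real.pi / κ i))) := by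
  have hloc : ∀ᶠ δ : ℝ in 𝓝[>] 0, ∀ i, Tendsto
      (fun n : ℕ => Real.sqrt n * ∫ x in Set.Ioo (s i - δ) (s i + δ), g x * E x ^ n) atTop
      (𝓝 (g (s i) * Real.sqrt (2 * Real.pi / κ i))) := by
    refine eventually_all.2 fun i => ?_
    obtain ⟨u, hu1, hu2⟩ := hE i
    exact tendsto_laplace_local hEm hgm (hκ i) (hg i) hu1 hu2
  have hpos : ∀ᶠ δ : ℝ in 𝓝[>] 0, ∀ i, δ < s i :=
    eventually_all.2 fun i => mem_nhdsWithin_of_mem_nhds (gt_mem_nhds (hs0 i))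
  have hsep : ∀ᶠ δ : ℝ in 𝓝[>] 0, ∀ i j, i ≠ j → δ < |s i - s j| / 2 := by
    refine eventually_all.2 fun i => eventually_all.2 fun j => ?_
    by_cases hij : i = j
    · exact Eventually.of_forall fun δ h => absurd hij h
    · have : 0 < |s i - s j| / 2 := half_pos (abs_pos.2 (sub_ne_zero.2 (hs.ne hij)))
      filter_upwards [mem_nhdsWithin_of_mem_nhds (gt_mem_nhds this)] with δ hδ _ using hδ
  obtain ⟨δ, hδl, hδp, hδs, hδ0⟩ := (hloc.and (hpos.and (hsep.and self_mem_nhdsWithin))).exists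
  have hδ0' : 0 < δ := hδ0
  set I : ι → Set ℝ := fun i => Set.Ioo (s i - δ) (s i + δ) with hI
  set U : Set ℝ := ⋃ i, I i with hU
  have hUm : MeasurableSet U := MeasurableSet.iUnion fun i => measurableSet_Ioo
  have hIsub : ∀ i, I i ⊆ Set.Ioi 0 := fun i x hx => by
    have := hδp i
    simp only [hI, Set.mem_Ioo] at hx
    simp only [Set.mem_Ioi]
    linarith [hx.1]
  have hUsub : U ⊆ Set.Ioi 0 := Set.iUnion_subset hIsub
  have hdisj : Pairwise (Function.onFun Disjoint I) := by
    intro i j hij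
    refine Set.disjoint_left.2 fun x hx hy => ?_
    have h1 := hδs i j hij
    simp only [hI, Set.mem_Ioo] at hx hy
    have : |s i - s j| < 2 * δ := by
      rw [abs_lt]
      constructor <;> linarith [hx.1, hx.2, hy.1, hy.2]
    linarith
  obtain ⟨θ, hθ0, hθ1, hθ⟩ := htail δ hδ0'
  have hdecomp : ∀ n, n₀ ≤ n → Real.sqrt n * ∫ x in Set.Ioi 0, g x * E x ^ n =
      (∑ i, Real.sqrt n * ∫ x in I i, g x * E x ^ n) +
        Real.sqrt n * ∫ x in Set.Ioi 0 \ U, g x * E x ^ n := by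
    intro n hn
    have hi := integrableOn_mul_pow hEm hgm hE0 hE1 hint hn
    rw [← Finset.mul_sum, ← mul_add, ← integral_iUnion_fintype (fun i => measurableSet_Ioo) hdisj
      (fun i => hi.mono_set (hIsub i)), ← setIntegral_union Set.disjoint_sdiff_right
      (measurableSet_Ioi.diff hUm) (hi.mono_set hUsub) (hi.mono_set Set.sdiff_subset),
      Set.union_sdiff_cancel hUsub]
  -- Off the peaks `E ≤ θ < 1`, so `|g| E^n ≤ θ^{n - n₀} |g| E^{n₀}`. Only the power `n₀` is known
  -- to be integrable against `g`; the geometric factor beats `√n`.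
  have hrest : Tendsto (fun n : ℕ => Real.sqrt n * ∫ x in Set.Ioi 0 \ U, g x * E x ^ n) atTop
      (𝓝 0) := by
    set C := ∫ x in Set.Ioi 0 \ U, |g x * E x ^ n₀| with hC
    have hCint : IntegrableOn (fun x => |g x * E x ^ n₀|) (Set.Ioi 0 \ U) :=
      (hint.mono_set Set.sdiff_subset).abs
    have hbound : ∀ n, n₀ ≤ n → |Real.sqrt n * ∫ x in Set.Ioi 0 \ U, g x * E x ^ n| ≤
        (n : ℝ) * θ ^ (n - n₀) * C := by
      intro n hn
      have hn1 : Real.sqrt n ≤ n := by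
        rcases Nat.eq_zero_or_pos n with rfl | hp
        · simp
        · rw [Real.sqrt_le_left (by positivity)]
          have : (1 : ℝ) ≤ n := by exact_mod_cast hp
          nlinarith
      have h2 : |∫ x in Set.Ioi 0 \ U, g x * E x ^ n| ≤ θ ^ (n - n₀) * C := by
        rw [hC, ← integral_const_mul, ← Real.norm_eq_abs]
        refine norm_integral_le_of_norm_le (hCint.const_mul _) ?_
        filter_upwards [ae_restrict_mem (measurableSet_Ioi.diff hUm)] with x hx
        have hx2 : ∀ i, δ ≤ |x - s i| := by
          intro i
          by_contra hlt
          push Not at hlt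
          rw [abs_lt] at hlt
          exact hx.2 (Set.mem_iUnion.2 ⟨i, by
            simp only [hI, Set.mem_Ioo]
            constructor <;> linarith [hlt.1, hlt.2]⟩)
        have h3 := pow_le_pow_left₀ (hE0 x) (hθ x hx.1 hx2) (n - n₀)
        have h4 : E x ^ n = E x ^ (n - n₀) * E x ^ n₀ := by
          rw [← pow_add, Nat.sub_add_cancel hn]
        rw [Real.norm_eq_abs, h4, show g x * (E x ^ (n - n₀) * E x ^ n₀) =
          E x ^ (n - n₀) * (g x * E x ^ n₀) by ring, abs_mul, abs_of_nonneg (pow_nonneg (hE0 x) _)]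
        exact mul_le_mul_of_nonneg_right h3 (abs_nonneg _)
      rw [abs_mul, abs_of_nonneg (Real.sqrt_nonneg _), mul_assoc]
      exact mul_le_mul hn1 h2 (abs_nonneg _) (Nat.cast_nonneg _)
    have hlim : Tendsto (fun n : ℕ => (n : ℝ) * θ ^ (n - n₀) * C) atTop (𝓝 0) := by
      have h1 : Tendsto (fun k : ℕ => ((k : ℝ) * θ ^ k + n₀ * θ ^ k) * C) atTop (𝓝 0) := by
        have := ((tendsto_self_mul_const_pow_of_lt_one hθ0 hθ1).add
          ((tendsto_pow_atTop_nhds_zero_of_lt_one hθ0 hθ1).const_mul (n₀ : ℝ))).mul_const C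
        simpa using this
      have h2 := h1.comp (tendsto_sub_atTop_nat n₀)
      refine h2.congr' ?_
      filter_upwards [eventually_ge_atTop n₀] with n hn
      simp only [Function.comp]
      rw [← add_mul, ← Nat.cast_add, Nat.sub_add_cancel hn]
    refine squeeze_zero_norm' ?_ hlim
    filter_upwards [eventually_ge_atTop n₀] with n hn using hbound n hn
  have hsum := (tendsto_finsetSum Finset.univ fun i _ => hδl i).add hrest
  rw [add_zero] at hsum
  refine hsum.congr' ?_
  filter_upwards [eventually_ge_atTop n₀] with n hn using (hdecomp n hn).symm

end LaplaceMethod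

/-! ### Radial observables of a determinantal gas -/

section RadialObservables

/-- The density `∏_{j < k} |z_k - z_j|² ∏_j ω(z_j)` of a determinantal gas with weight `ω`. -/
def vandermondeWeight (ω : ℂ → ℝ) (n : ℕ) (z : Fin n → ℂ) : ℝ :=
  ‖(Matrix.vandermonde z).det‖ ^ 2 * ∏ j, ω (z j)

/-- A weight function on the plane that is nonnegative, radial, and has enough moments for the
`n`-particle gas. -/
structure IsGasWeight (ω : ℂ → ℝ) (n : ℕ) : Prop where
  nonneg : ∀ z, 0 ≤ ω z
  measurable : Measurable ω
  radial : ∀ z w : ℂ, ‖z‖ = ‖w‖ → ω z = ω w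
  integrable : ∀ k : ℕ, k ≤ 2 * (n - 1) → Integrable (fun z : ℂ => ‖z‖ ^ k * ω z)

/-- Bounded measurable observables that depend symmetrically on the moduli of the particles. -/
structure IsRadialObservable {n : ℕ} (F : (Fin n → ℂ) → ℝ) : Prop where
  measurable : Measurable F
  bounded : ∃ C, ∀ z, |F z| ≤ C
  radial : ∀ z w, (∀ j, ‖z j‖ = ‖w j‖) → F z = F w
  symmetric : ∀ (σ : Equiv.Perm (Fin n)) z, F (z ∘ σ) = F z

/-- One term in the expansion of the squared Vandermonde determinant. -/
def gasTerm (ω : ℂ → ℝ) {n : ℕ} (F : (Fin n → ℂ) → ℝ) (σ τ : Equiv.Perm (Fin n))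
    (z : Fin n → ℂ) : ℂ :=
  (∏ i, (z i ^ (σ i : ℕ) * (starRingEnd ℂ) (z i) ^ (τ i : ℕ) * (ω (z i) : ℂ))) * (F z : ℂ)

/-- Take `c = e^{iπ/(a - b)}`. The value `-1` makes an integral invariant under the rotation by `c`
equal to its own negative. -/
lemma exists_norm_one_pow_mul_conj_pow {a b : ℕ} (hab : a ≠ b) :
    ∃ c : ℂ, ‖c‖ = 1 ∧ c ^ a * (starRingEnd ℂ) c ^ b = -1 := by
  have hab' : (a : ℂ) - b ≠ 0 := sub_ne_zero.2 (by exact_mod_cast hab)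
  refine ⟨Complex.exp ((Real.pi / ((a : ℝ) - b) : ℝ) * Complex.I), Complex.norm_exp_ofReal_mul_I _, ?_⟩
  rw [← Complex.exp_conj, ← Complex.exp_nat_mul, ← Complex.exp_nat_mul, ← Complex.exp_add,
    ← Complex.exp_pi_mul_I]
  congr 1
  simp only [map_mul, Complex.conj_ofReal, Complex.conj_I]
  push_cast
  field_simp
  ring

lemma measurePreserving_mul_of_norm_one {c : ℂ} (hc : ‖c‖ = 1) :
    MeasurePreserving (fun z : ℂ => c * z) volume volume := by
  have := (rotation ⟨c, by simp [Submonoid.unitSphere, hc]⟩).measurePreserving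
  exact this

/-- Write the squared modulus as the determinant times its conjugate and apply the Leibniz formula
to each. -/
lemma vandermondeWeight_expansion (ω : ℂ → ℝ) {n : ℕ} (F : (Fin n → ℂ) → ℝ) (z : Fin n → ℂ) :
    ((vandermondeWeight ω n z * F z : ℝ) : ℂ) = ∑ σ : Equiv.Perm (Fin n), ∑ τ : Equiv.Perm (Fin n),
      ((Equiv.Perm.sign σ : ℤ) : ℂ) * ((Equiv.Perm.sign τ : ℤ) : ℂ) * gasTerm ω F σ τ z := by
  have hdet : (Matrix.vandermonde z).det =
      ∑ σ : Equiv.Perm (Fin n), ((Equiv.Perm.sign σ : ℤ) : ℂ) * ∏ i, z i ^ (σ i : ℕ) := by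
    rw [← Matrix.det_transpose, Matrix.det_apply']
    rfl
  have hconj : (starRingEnd ℂ) (Matrix.vandermonde z).det =
      ∑ τ : Equiv.Perm (Fin n), ((Equiv.Perm.sign τ : ℤ) : ℂ) *
        ∏ i, (starRingEnd ℂ) (z i) ^ (τ i : ℕ) := by
    rw [hdet, map_sum]
    refine Finset.sum_congr rfl fun τ _ => ?_
    rw [map_mul, map_prod, map_intCast]
    simp
  have hsq : ((‖(Matrix.vandermonde z).det‖ ^ 2 : ℝ) : ℂ) =
      (Matrix.vandermonde z).det * (starRingEnd ℂ) (Matrix.vandermonde z).det := by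
    rw [Complex.mul_conj, Complex.normSq_eq_norm_sq]
  rw [vandermondeWeight, Complex.ofReal_mul, Complex.ofReal_mul, hsq, hconj, hdet,
    Finset.sum_mul_sum, Finset.sum_mul, Finset.sum_mul]
  refine Finset.sum_congr rfl fun σ _ => ?_
  rw [Finset.sum_mul, Finset.sum_mul]
  refine Finset.sum_congr rfl fun τ _ => ?_
  rw [gasTerm, Finset.prod_mul_distrib, Finset.prod_mul_distrib, Complex.ofReal_prod]
  ring

variable {ω : ℂ → ℝ} {n : ℕ} {F : (Fin n → ℂ) → ℝ}

lemma IsGasWeight.integrable_gasTerm (hω : IsGasWeight ω n) (hFm : Measurable F)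
    (hF : ∃ C, ∀ z, |F z| ≤ C) (σ τ : Equiv.Perm (Fin n)) : Integrable (gasTerm ω F σ τ) := by
  obtain ⟨C, hC⟩ := hF
  have hprod : Integrable (fun z : Fin n → ℂ => ∏ i, (z i ^ (σ i : ℕ) *
      (starRingEnd ℂ) (z i) ^ (τ i : ℕ) * (ω (z i) : ℂ))) := by
    refine Integrable.fintype_prod (f := fun i (w : ℂ) => w ^ (σ i : ℕ) *
      (starRingEnd ℂ) w ^ (τ i : ℕ) * (ω w : ℂ)) (μ := fun _ => volume) fun i => ?_
    have hm : Measurable (fun w : ℂ => w ^ (σ i : ℕ) *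
        (starRingEnd ℂ) w ^ (τ i : ℕ) * (ω w : ℂ)) := by
      have h1 : Measurable (fun w : ℂ => (starRingEnd ℂ) w) := Complex.continuous_conj.measurable
      have h2 := hω.measurable
      exact ((measurable_id.pow_const _).mul (h1.pow_const _)).mul
        (Complex.measurable_ofReal.comp h2)
    refine (hω.integrable ((σ i : ℕ) + τ i) ?_).mono hm.aestronglyMeasurable ?_
    · have h1 := (σ i).isLt
      have h2 := (τ i).isLt
      omega
    · refine Eventually.of_forall fun w => le_of_eq ?_
      simp [pow_add]
  exact hprod.mul_bdd (c := C) (Complex.measurable_ofReal.comp hFm).aestronglyMeasurable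
    (Eventually.of_forall fun z => by simpa using hC z)

/-- Rotating only a particle `i` with `σ i ≠ τ i` preserves Lebesgue measure, the weight and `F`,
but changes the sign of the term. -/
lemma IsGasWeight.integral_gasTerm_of_ne (hω : IsGasWeight ω n) (hF : IsRadialObservable F)
    {σ τ : Equiv.Perm (Fin n)} (h : σ ≠ τ) : ∫ z, gasTerm ω F σ τ z = 0 := by
  obtain ⟨i, hi⟩ : ∃ i, σ i ≠ τ i := by
    by_contra hcon
    push Not at hcon
    exact h (Equiv.ext hcon)
  obtain ⟨c, hc, hpow⟩ := exists_norm_one_pow_mul_conj_pow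
    (show (σ i : ℕ) ≠ (τ i : ℕ) from fun h => hi (Fin.ext h))
  set d : Fin n → ℂ := fun j => if j = i then c else 1 with hd
  have hdn : ∀ j, ‖d j‖ = 1 := by
    intro j
    simp only [hd]
    split_ifs <;> simp [hc]
  have hT : MeasurePreserving (fun (z : Fin n → ℂ) j => d j * z j) volume volume :=
    volume_preserving_pi fun j => measurePreserving_mul_of_norm_one (hdn j)
  have hneg : ∀ z : Fin n → ℂ, gasTerm ω F σ τ (fun j => d j * z j) = -gasTerm ω F σ τ z := by
    intro z
    have hnorm : ∀ j, ‖d j * z j‖ = ‖z j‖ := fun j => by rw [norm_mul, hdn, one_mul]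
    simp only [gasTerm]
    rw [hF.radial _ z hnorm]
    have hfac : ∀ j, (d j * z j) ^ (σ j : ℕ) * (starRingEnd ℂ) (d j * z j) ^ (τ j : ℕ) *
        (ω (d j * z j) : ℂ) = (if j = i then -1 else 1) *
          (z j ^ (σ j : ℕ) * (starRingEnd ℂ) (z j) ^ (τ j : ℕ) * (ω (z j) : ℂ)) := by
      intro j
      rw [hω.radial _ _ (hnorm j), map_mul, mul_pow, mul_pow]
      by_cases hj : j = i
      · subst hj
        simp only [hd, if_true]
        rw [← hpow]
        ring
      · simp only [hd, hj, if_false, map_one, one_pow, one_mul]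
    simp only [hfac]
    rw [Finset.prod_mul_distrib, Finset.prod_ite_eq' Finset.univ i]
    simp
  have hint := hω.integrable_gasTerm hF.measurable hF.bounded σ τ
  have h1 : ∫ z, gasTerm ω F σ τ z =
      ∫ z : Fin n → ℂ, gasTerm ω F σ τ (fun j => d j * z j) := by
    conv_lhs => rw [← hT.map_eq]
    rw [integral_map hT.measurable.aemeasurable]
    rw [hT.map_eq]
    exact hint.aestronglyMeasurable
  simp only [hneg, integral_neg] at h1
  exact self_eq_neg.1 h1

/-- Relabelling the particles by `σ` sorts the exponents, and `F` is symmetric; the result no longer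
depends on `σ`. -/
lemma integral_gasTerm_self {F : (Fin n → ℂ) → ℝ}
    (hF : IsRadialObservable F) (σ : Equiv.Perm (Fin n)) :
    ∫ z, gasTerm ω F σ σ z =
      ((∫ z : Fin n → ℂ, (∏ i : Fin n, (‖z i‖ ^ (2 * (i : ℕ)) * ω (z i))) * F z : ℝ) : ℂ) := by
  have hterm : ∀ z : Fin n → ℂ, gasTerm ω F σ σ z =
      (((∏ i : Fin n, (‖z i‖ ^ (2 * (σ i : ℕ)) * ω (z i))) * F z : ℝ) : ℂ) := by
    intro z
    rw [gasTerm]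
    push_cast
    congr 1
    refine Finset.prod_congr rfl fun i _ => ?_
    rw [← mul_pow, Complex.mul_conj, Complex.normSq_eq_norm_sq, pow_mul]
    push_cast
    rfl
  simp only [hterm]
  rw [integral_complex_ofReal]
  congr 1
  have he := volume_measurePreserving_piCongrLeft (fun _ : Fin n => ℂ) σ
  symm
  rw [← he.integral_comp']
  congr 1
  ext z
  set y := MeasurableEquiv.piCongrLeft (fun _ : Fin n => ℂ) σ z with hy
  have hyz : ∀ i, y (σ i) = z i := fun i => Equiv.piCongrLeft_apply_apply (fun _ => ℂ) σ z i
  have hyz' : y ∘ σ = z := funext hyz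
  rw [← hF.symmetric σ y, hyz']
  congr 1
  rw [← Equiv.prod_comp σ fun i => ‖y i‖ ^ (2 * (i : ℕ)) * ω (y i)]
  simp only [hyz]

lemma IsGasWeight.integrable_vandermondeWeight_mul (hω : IsGasWeight ω n) (hFm : Measurable F)
    (hF : ∃ C, ∀ z, |F z| ≤ C) :
    Integrable (fun z => vandermondeWeight ω n z * F z) := by
  have : Integrable (fun z => ((vandermondeWeight ω n z * F z : ℝ) : ℂ)) := by
    simp only [vandermondeWeight_expansion]
    exact integrable_finsetSum _ fun σ _ => integrable_finsetSum _ fun τ _ =>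
      (hω.integrable_gasTerm hFm hF σ τ).const_mul _
  exact this.re

/-- Under the gas, the moduli of the particles are distributed like independent variables, up to
their order. -/
lemma IsGasWeight.integral_vandermondeWeight_mul (hω : IsGasWeight ω n)
    (hF : IsRadialObservable F) :
    ∫ z, vandermondeWeight ω n z * F z =
      (n.factorial : ℝ) * ∫ z : Fin n → ℂ, (∏ i, (‖z i‖ ^ (2 * (i : ℕ)) * ω (z i))) * F z := by
  have hint := hω.integrable_gasTerm hF.measurable hF.bounded
  rw [← Complex.ofReal_inj, ← integral_complex_ofReal]
  simp only [vandermondeWeight_expansion]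
  rw [integral_finsetSum _ fun σ _ => integrable_finsetSum _ fun τ _ => (hint σ τ).const_mul _]
  have hinner : ∀ σ : Equiv.Perm (Fin n), ∫ z, ∑ τ : Equiv.Perm (Fin n),
      ((Equiv.Perm.sign σ : ℤ) : ℂ) * ((Equiv.Perm.sign τ : ℤ) : ℂ) * gasTerm ω F σ τ z =
      ((∫ z : Fin n → ℂ, (∏ i, (‖z i‖ ^ (2 * (i : ℕ)) * ω (z i))) * F z : ℝ) : ℂ) := by
    intro σ
    rw [integral_finsetSum _ fun τ _ => (hint σ τ).const_mul _, Finset.sum_eq_single σ]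
    · rw [integral_const_mul, integral_gasTerm_self hF]
      have : ((Equiv.Perm.sign σ : ℤ) : ℂ) * ((Equiv.Perm.sign σ : ℤ) : ℂ) = 1 := by
        rcases Int.units_eq_one_or (Equiv.Perm.sign σ) with h | h <;> simp [h]
      rw [this, one_mul]
    · intro τ _ hτ
      rw [integral_const_mul, hω.integral_gasTerm_of_ne hF hτ.symm, mul_zero]
    · simp
  simp only [hinner]
  simp [Fintype.card_perm]

/-- The `j`-th radial moment of the weight. -/
def gasMoment (ω : ℂ → ℝ) (j : ℕ) : ℝ := ∫ z, ‖z‖ ^ (2 * j) * ω z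

/-- The mean of `h` under the probability density proportional to `|z|^{2j} ω(z)`. -/
def gasMean (ω : ℂ → ℝ) (j : ℕ) (h : ℂ → ℝ) : ℝ :=
  (∫ z, ‖z‖ ^ (2 * j) * ω z * h z) / gasMoment ω j

lemma integral_prod_gas (hM : ∀ i : Fin n, gasMoment ω i ≠ 0) (φ : Fin n → ℂ → ℝ) :
    ∫ z : Fin n → ℂ, (∏ i, (‖z i‖ ^ (2 * (i : ℕ)) * ω (z i))) * ∏ i, φ i (z i) =
      (∏ i : Fin n, gasMoment ω i) * ∏ i : Fin n, gasMean ω i (φ i) := by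
  simp only [← Finset.prod_mul_distrib]
  rw [integral_fintype_prod_volume_eq_prod (fun (i : Fin n) (w : ℂ) =>
    ‖w‖ ^ (2 * (i : ℕ)) * ω w * φ i w)]
  refine Finset.prod_congr rfl fun i _ => ?_
  rw [gasMean, mul_div_cancel₀ _ (hM i)]

lemma gasMean_one {j : ℕ} (hM : gasMoment ω j ≠ 0) : gasMean ω j (fun _ => 1) = 1 := by
  simp only [gasMean, mul_one]
  exact div_self hM

lemma integral_single_gas (hM : ∀ i : Fin n, gasMoment ω i ≠ 0) (j : Fin n) (h : ℂ → ℝ) :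
    ∫ z : Fin n → ℂ, (∏ i, (‖z i‖ ^ (2 * (i : ℕ)) * ω (z i))) * h (z j) =
      (∏ i : Fin n, gasMoment ω i) * gasMean ω j h := by
  have h1 := integral_prod_gas hM fun i => if i = j then h else fun _ => 1
  have h2 : ∀ z : Fin n → ℂ, ∏ i, (if i = j then h else fun _ => 1) (z i) = h (z j) := by
    intro z
    rw [Finset.prod_eq_single j]
    · simp
    · intro b _ hb
      simp [hb]
    · simp
  have h3 : ∏ i : Fin n, gasMean ω i (if i = j then h else fun _ => 1) = gasMean ω j h := by
    rw [Finset.prod_eq_single j]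
    · simp
    · intro b _ hb
      simp only [hb, if_false]
      exact gasMean_one (hM b)
    · simp
  simpa only [h2, h3] using h1

lemma integral_pair_gas (hM : ∀ i : Fin n, gasMoment ω i ≠ 0) {j k : Fin n} (hjk : j ≠ k)
    (h g : ℂ → ℝ) :
    ∫ z : Fin n → ℂ, (∏ i, (‖z i‖ ^ (2 * (i : ℕ)) * ω (z i))) * (h (z j) * g (z k)) =
      (∏ i : Fin n, gasMoment ω i) * (gasMean ω j h * gasMean ω k g) := by
  have h1 := integral_prod_gas hM fun i => if i = j then h else if i = k then g else fun _ => 1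
  have h2 : ∀ z : Fin n → ℂ,
      ∏ i, (if i = j then h else if i = k then g else fun _ => 1) (z i) = h (z j) * g (z k) := by
    intro z
    rw [← Finset.prod_subset (Finset.subset_univ {j, k}), Finset.prod_pair hjk]
    · simp [hjk.symm]
    · intro i _ hi
      simp only [Finset.mem_insert, Finset.mem_singleton, not_or] at hi
      simp [hi.1, hi.2]
  have h3 : ∏ i : Fin n, gasMean ω i (if i = j then h else if i = k then g else fun _ => 1) =
      gasMean ω j h * gasMean ω k g := by
    rw [← Finset.prod_subset (Finset.subset_univ {j, k}), Finset.prod_pair hjk]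
    · simp [hjk.symm]
    · intro i _ hi
      simp only [Finset.mem_insert, Finset.mem_singleton, not_or] at hi
      simp only [hi.1, hi.2, if_false]
      exact gasMean_one (hM i)
  simpa only [h2, h3] using h1

end RadialObservables

/-! ### Moments of the Coulomb gas -/

section Moments

/-- The one-particle weight `e^{-nQ} / π`. -/
def particleWeight (Q : ℂ → EReal) (n : ℕ) (z : ℂ) : ℝ := boltzmann Q z ^ n / Real.pi

variable {Q : ℂ → EReal} {n : ℕ}

lemma IsAdmissible.isGasWeight (hQ : IsAdmissible Q) (hn : 0 < n) :
    IsGasWeight (particleWeight Q n) n := by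
  have hm : Measurable (particleWeight Q n) := (hQ.measurable_boltzmann.pow_const n).div_const _
  refine ⟨fun z => div_nonneg (pow_nonneg (boltzmann_nonneg z) n) Real.pi_pos.le, hm,
    fun z w hzw => ?_, fun k hk => ?_⟩
  · rw [particleWeight, particleWeight, hQ.boltzmann_radial z, hQ.boltzmann_radial w, hzw]
  obtain ⟨a, ha, R, hR, hfar⟩ := hQ.exists_boltzmann_le_rpow
  obtain ⟨B, hB, hBw⟩ := hQ.exists_boltzmann_le
  have hn0 : (0 : ℝ) < n := by exact_mod_cast hn
  -- This is `2an - 2(n - 1)`, the decay exponent in the worst case `k = 2(n - 1)`; it exceeds the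
  -- real dimension `2`.
  set r : ℝ := 2 + 2 * n * (a - 1) with hr
  have hr2 : 2 < r := by
    have : 0 < 2 * (n : ℝ) * (a - 1) := by
      have := sub_pos.2 ha
      positivity
    linarith
  have hdom : Integrable (fun z : ℂ => (1 + ‖z‖) ^ (-r)) :=
    integrable_one_add_norm (by rw [Complex.finrank_real_complex]; exact_mod_cast hr2)
  have hR0 : 0 < R := by linarith
  refine ((hdom.const_mul (max ((2 : ℝ) ^ r) (R ^ k * B ^ n * (1 + R) ^ r))).div_const
    Real.pi).mono ((measurable_norm.pow_const k).mul hm).aestronglyMeasurable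
    (Eventually.of_forall fun z => ?_)
  have h1z : 0 < 1 + ‖z‖ := by positivity
  have hpw : 0 < (1 + ‖z‖) ^ (-r) := Real.rpow_pos_of_pos h1z _
  have key : ‖z‖ ^ k * boltzmann Q z ^ n ≤
      max ((2 : ℝ) ^ r) (R ^ k * B ^ n * (1 + R) ^ r) * (1 + ‖z‖) ^ (-r) := by
    rcases le_total R ‖z‖ with hz | hz
    · have hz1 : 1 ≤ ‖z‖ := hR.le.trans hz
      have hz0 : 0 < ‖z‖ := by linarith
      have h1 : ‖z‖ ^ k * boltzmann Q z ^ n ≤ ‖z‖ ^ (-r) := by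
        calc ‖z‖ ^ k * boltzmann Q z ^ n ≤ ‖z‖ ^ (2 * (n - 1)) * (‖z‖ ^ (-(2 * a))) ^ n := by
              apply mul_le_mul (pow_le_pow_right₀ hz1 hk)
                (pow_le_pow_left₀ (boltzmann_nonneg z) (hfar z hz) n)
                (pow_nonneg (boltzmann_nonneg z) n) (by positivity)
          _ = ‖z‖ ^ (-r) := by
              rw [← Real.rpow_natCast, ← Real.rpow_natCast, ← Real.rpow_mul hz0.le,
                ← Real.rpow_add hz0]
              congr 1
              rw [Nat.cast_mul, Nat.cast_sub (by omega : 1 ≤ n), hr]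
              push_cast
              ring
      have h2 : ‖z‖ ^ (-r) ≤ (2 : ℝ) ^ r * (1 + ‖z‖) ^ (-r) := by
        have h3 : ((1 + ‖z‖) / 2) ^ r ≤ ‖z‖ ^ r :=
          Real.rpow_le_rpow (by positivity) (by linarith) (by linarith)
        rw [Real.div_rpow h1z.le two_pos.le] at h3
        rw [Real.rpow_neg hz0.le, Real.rpow_neg h1z.le, ← div_eq_mul_inv,
          inv_le_comm₀ (by positivity) (by positivity), inv_div]
        exact h3
      refine (h1.trans h2).trans ?_
      exact mul_le_mul_of_nonneg_right (le_max_left _ _) hpw.le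
    · have h1 : ‖z‖ ^ k * boltzmann Q z ^ n ≤ R ^ k * B ^ n :=
        mul_le_mul (pow_le_pow_left₀ (norm_nonneg _) hz k)
          (pow_le_pow_left₀ (boltzmann_nonneg z) (hBw z) n)
          (pow_nonneg (boltzmann_nonneg z) n) (by positivity)
      have h2 : 1 ≤ (1 + R) ^ r * (1 + ‖z‖) ^ (-r) := by
        rw [Real.rpow_neg h1z.le, ← div_eq_mul_inv, one_le_div (by positivity)]
        exact Real.rpow_le_rpow h1z.le (by linarith) (by linarith)
      calc ‖z‖ ^ k * boltzmann Q z ^ n ≤ R ^ k * B ^ n * 1 := by rw [mul_one]; exact h1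
        _ ≤ R ^ k * B ^ n * ((1 + R) ^ r * (1 + ‖z‖) ^ (-r)) :=
            mul_le_mul_of_nonneg_left h2 (by positivity)
        _ = (R ^ k * B ^ n * (1 + R) ^ r) * (1 + ‖z‖) ^ (-r) := by ring
        _ ≤ _ := mul_le_mul_of_nonneg_right (le_max_right _ _) hpw.le
  rw [particleWeight, ← mul_div_assoc, Real.norm_of_nonneg, Real.norm_of_nonneg]
  · exact div_le_div_of_nonneg_right key Real.pi_pos.le
  · have : 0 ≤ (2 : ℝ) ^ r := by positivity
    have := this.trans (le_max_left _ (R ^ k * B ^ n * (1 + R) ^ r))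
    have := Real.pi_pos
    positivity
  · have := boltzmann_nonneg (Q := Q) z
    have := Real.pi_pos
    positivity

/-- `Q` is finite near a coincidence point, so the integrand is positive on a neighbourhood; `z₀ ≠
0` keeps the power of `‖z‖` from vanishing. -/
lemma IsAdmissible.gasMoment_pos (hQ : IsAdmissible Q) (hn : 0 < n) {z₀ : ℂ} (hz₀ : z₀ ≠ 0)
    (hmem : z₀ ∈ coincidenceSet Q) {j : ℕ} (hj : j < n) :
    0 < gasMoment (particleWeight Q n) j := by
  have hω := hQ.isGasWeight hn
  have hint := hω.integrable (2 * j) (by omega)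
  rw [gasMoment, integral_pos_iff_support_of_nonneg
    (fun z => mul_nonneg (pow_nonneg (norm_nonneg z) _) (hω.nonneg z)) hint]
  have hnhds : Function.support (fun z : ℂ => ‖z‖ ^ (2 * j) * particleWeight Q n z) ∈ 𝓝 z₀ := by
    filter_upwards [(hQ.contDiffAt_of_mem_coincidenceSet hmem).2, isOpen_ne.mem_nhds hz₀]
      with z hz hz0
    rw [Function.mem_support, particleWeight, hQ.boltzmann_eq_exp hz]
    have h0 : 0 < ‖z‖ := norm_pos_iff.2 hz0
    have := Real.pi_pos
    have := Real.exp_pos (-(Q z).toReal)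
    positivity
  exact Measure.measure_pos_of_mem_nhds volume hnhds

lemma IsAdmissible.gasWeight_eq (hQ : IsAdmissible Q) (hn : 0 < n) (z : Fin n → ℂ) :
    gasWeight Q n z = ENNReal.ofReal (vandermondeWeight (particleWeight Q n) n z) := by
  have hω := hQ.isGasWeight hn
  rw [gasWeight, vandermondeWeight, ENNReal.ofReal_mul (by positivity),
    ENNReal.ofReal_prod_of_nonneg fun j _ => hω.nonneg _]
  congr 1
  · rw [Matrix.det_vandermonde, norm_prod, ← Finset.prod_pow,
      ENNReal.ofReal_prod_of_nonneg fun j _ => by positivity]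
    refine Finset.prod_congr rfl fun j _ => ?_
    rw [norm_prod, ← Finset.prod_pow, ENNReal.ofReal_prod_of_nonneg fun j _ => by positivity]
    refine Finset.prod_congr rfl fun k _ => ?_
    rw [ENNReal.ofReal_pow (norm_nonneg _), ofReal_norm]
  · refine Finset.prod_congr rfl fun j _ => ?_
    rw [hQ.exp_neg_nsmul hn, particleWeight, ENNReal.ofReal_div_of_pos Real.pi_pos]

lemma IsGasWeight.vandermondeWeight_nonneg {ω : ℂ → ℝ} (hω : IsGasWeight ω n) (z : Fin n → ℂ) :
    0 ≤ vandermondeWeight ω n z :=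
  mul_nonneg (by positivity) (Finset.prod_nonneg fun j _ => hω.nonneg _)

lemma IsGasWeight.measurable_vandermondeWeight {ω : ℂ → ℝ} (hω : IsGasWeight ω n) :
    Measurable (vandermondeWeight ω n) := by
  have h1 : Continuous fun z : Fin n → ℂ => ‖(Matrix.vandermonde z).det‖ ^ 2 := by
    simp only [Matrix.det_vandermonde]
    fun_prop
  refine h1.measurable.mul (Finset.measurable_prod _ fun j _ => ?_)
  exact hω.measurable.comp (measurable_pi_apply j)


lemma isRadialObservable_const (c : ℝ) : IsRadialObservable (fun _ : Fin n → ℂ => c) :=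
  ⟨measurable_const, ⟨|c|, fun _ => le_rfl⟩, fun _ _ _ => rfl, fun _ _ => rfl⟩

lemma partitionFunction_eq (hQ : IsAdmissible Q) (hn : 0 < n)
    (hM : ∀ i : Fin n, 0 < gasMoment (particleWeight Q n) i) : partitionFunction Q n =
    ENNReal.ofReal (n.factorial * ∏ i : Fin n, gasMoment (particleWeight Q n) i) := by
  have hω := hQ.isGasWeight hn
  have h1 := hω.integral_vandermondeWeight_mul (isRadialObservable_const (n := n) 1)
  have h2 := integral_prod_gas (fun i => (hM i).ne') (fun (_ : Fin n) (_ : ℂ) => (1 : ℝ))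
  have h3 : ∏ i : Fin n, gasMean (particleWeight Q n) i (fun _ => 1) = 1 :=
    Finset.prod_eq_one fun i _ => gasMean_one (hM i).ne'
  simp only [Finset.prod_const_one, h3] at h2
  rw [h2, mul_one] at h1
  simp only [mul_one] at h1
  have hint := hω.integrable_vandermondeWeight_mul (F := fun _ => 1) measurable_const
    ⟨1, fun _ => by simp⟩
  simp only [mul_one] at hint
  rw [partitionFunction, ← h1, ofReal_integral_eq_lintegral_ofReal hint
    (Eventually.of_forall hω.vandermondeWeight_nonneg)]
  simp only [hQ.gasWeight_eq hn]

lemma partition_pos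
    (hM : ∀ i : Fin n, 0 < gasMoment (particleWeight Q n) i) :
    0 < (n.factorial : ℝ) * ∏ i : Fin n, gasMoment (particleWeight Q n) i :=
  mul_pos (by exact_mod_cast n.factorial_pos) (Finset.prod_pos fun i _ => hM i)

lemma isProbabilityMeasure_gas (hQ : IsAdmissible Q) (hn : 0 < n)
    (hM : ∀ i : Fin n, 0 < gasMoment (particleWeight Q n) i) :
    IsProbabilityMeasure (gas Q n) := by
  refine ⟨?_⟩
  rw [gas, Measure.smul_apply, withDensity_apply _ MeasurableSet.univ, Measure.restrict_univ,
    smul_eq_mul, ← partitionFunction, partitionFunction_eq hQ hn hM]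
  exact ENNReal.inv_mul_cancel
    (ENNReal.ofReal_pos.2 (partition_pos hM)).ne' ENNReal.ofReal_ne_top

lemma integral_gas (hQ : IsAdmissible Q) (hn : 0 < n)
    (hM : ∀ i : Fin n, 0 < gasMoment (particleWeight Q n) i)
    {F : (Fin n → ℂ) → ℝ} (hF : IsRadialObservable F) :
    ∫ z, F z ∂(gas Q n) = (∏ i : Fin n, gasMoment (particleWeight Q n) i)⁻¹ *
      ∫ z : Fin n → ℂ, (∏ i, (‖z i‖ ^ (2 * (i : ℕ)) * particleWeight Q n (z i))) * F z := by
  have hω := hQ.isGasWeight hn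
  have hpos := partition_pos hM
  have hgw : gasWeight Q n = fun z => ENNReal.ofReal (vandermondeWeight (particleWeight Q n) n z) :=
    funext (hQ.gasWeight_eq hn)
  rw [gas, integral_smul_measure, partitionFunction_eq hQ hn hM, hgw,
    integral_withDensity_eq_integral_toReal_smul hω.measurable_vandermondeWeight.ennreal_ofReal
      (Eventually.of_forall fun _ => ENNReal.ofReal_lt_top)]
  simp only [ENNReal.toReal_ofReal (hω.vandermondeWeight_nonneg _), smul_eq_mul]
  rw [hω.integral_vandermondeWeight_mul hF, ENNReal.toReal_inv, ENNReal.toReal_ofReal hpos.le,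
    mul_inv]
  have : (n.factorial : ℝ) ≠ 0 := by exact_mod_cast n.factorial_ne_zero
  field_simp

/-- Bounded measurable radial functions on the plane. -/
structure IsRadialTest (h : ℂ → ℝ) : Prop where
  measurable : Measurable h
  abs_le_one : ∀ z, |h z| ≤ 1
  radial : ∀ z w : ℂ, ‖z‖ = ‖w‖ → h z = h w

/-- The linear statistic of a function. -/
def linearStatistic (h : ℂ → ℝ) {n : ℕ} (z : Fin n → ℂ) : ℝ := ∑ j, h (z j)

lemma IsRadialTest.isRadialObservable {h : ℂ → ℝ} (hh : IsRadialTest h) :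
    IsRadialObservable (linearStatistic h (n := n)) := by
  refine ⟨Finset.measurable_sum _ fun j _ => hh.measurable.comp (measurable_pi_apply j),
    ⟨n, fun z => ?_⟩, fun z w hzw => ?_, fun σ z => ?_⟩
  · refine (Finset.abs_sum_le_sum_abs _ _).trans ?_
    refine (Finset.sum_le_sum fun j _ => hh.abs_le_one (z j)).trans ?_
    simp
  · exact Finset.sum_congr rfl fun j _ => hh.radial _ _ (hzw j)
  · exact Equiv.sum_comp σ fun j => h (z j)

lemma IsRadialObservable.mul {F G : (Fin n → ℂ) → ℝ} (hF : IsRadialObservable F)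
    (hG : IsRadialObservable G) : IsRadialObservable (fun z => F z * G z) := by
  obtain ⟨C, hC⟩ := hF.bounded
  obtain ⟨D, hD⟩ := hG.bounded
  refine ⟨hF.measurable.mul hG.measurable, ⟨C * D, fun z => ?_⟩, fun z w h => ?_, fun σ z => ?_⟩
  · rw [abs_mul]
    exact mul_le_mul (hC z) (hD z) (abs_nonneg _) ((abs_nonneg _).trans (hC z))
  · rw [hF.radial z w h, hG.radial z w h]
  · rw [hF.symmetric σ z, hG.symmetric σ z]

lemma IsRadialObservable.memLp {F : (Fin n → ℂ) → ℝ} (hF : IsRadialObservable F)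
    (μ : Measure (Fin n → ℂ)) [IsFiniteMeasure μ] : MemLp F 2 μ := by
  obtain ⟨C, hC⟩ := hF.bounded
  exact MemLp.of_bound hF.measurable.aestronglyMeasurable C (Eventually.of_forall hC)

lemma IsGasWeight.integrable_prod {ω : ℂ → ℝ} (hω : IsGasWeight ω n) {F : (Fin n → ℂ) → ℝ}
    (hFm : Measurable F) (hF : ∃ C, ∀ z, |F z| ≤ C) :
    Integrable (fun z : Fin n → ℂ => (∏ i, (‖z i‖ ^ (2 * (i : ℕ)) * ω (z i))) * F z) := by
  obtain ⟨C, hC⟩ := hF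
  refine Integrable.mul_bdd (c := C) ?_ hFm.aestronglyMeasurable (Eventually.of_forall hC)
  exact Integrable.fintype_prod (f := fun (i : Fin n) (w : ℂ) => ‖w‖ ^ (2 * (i : ℕ)) * ω w)
    (μ := fun _ => volume) fun i => hω.integrable _ (by have := i.isLt; omega)

/-- The mean of a radial linear statistic. -/
lemma integral_linearStatistic (hQ : IsAdmissible Q) (hn : 0 < n)
    (hM : ∀ i : Fin n, 0 < gasMoment (particleWeight Q n) i)
    {h : ℂ → ℝ} (hh : IsRadialTest h) :
    ∫ z, linearStatistic h z ∂(gas Q n) = ∑ j : Fin n, gasMean (particleWeight Q n) j h := by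
  have hω := hQ.isGasWeight hn
  rw [integral_gas hQ hn hM hh.isRadialObservable]
  simp only [linearStatistic, Finset.mul_sum]
  rw [integral_finsetSum]
  · simp only [integral_single_gas (fun i => (hM i).ne')]
    rw [Finset.mul_sum]
    refine Finset.sum_congr rfl fun j _ => ?_
    rw [inv_mul_cancel_left₀ (Finset.prod_pos fun i _ => hM i).ne']
  · exact fun j _ => hω.integrable_prod (hh.measurable.comp (measurable_pi_apply j))
      ⟨1, fun z => hh.abs_le_one _⟩

/-- The covariance of two radial linear statistics. -/
lemma covariance_linearStatistic (hQ : IsAdmissible Q) (hn : 0 < n)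
    (hM : ∀ i : Fin n, 0 < gasMoment (particleWeight Q n) i)
    {h g : ℂ → ℝ} (hh : IsRadialTest h) (hg : IsRadialTest g) :
    covariance (linearStatistic h) (linearStatistic g) (gas Q n) =
      ∑ j : Fin n, (gasMean (particleWeight Q n) j (fun z => h z * g z) -
        gasMean (particleWeight Q n) j h * gasMean (particleWeight Q n) j g) := by
  have hω := hQ.isGasWeight hn
  have := isProbabilityMeasure_gas hQ hn hM
  have hFh := hh.isRadialObservable (n := n)
  have hFg := hg.isRadialObservable (n := n)
  have hMn : ∀ i : Fin n, gasMoment (particleWeight Q n) i ≠ 0 := fun i => (hM i).ne'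
  -- Independence: distinct indices factorize, and these terms later cancel against the product of
  -- the means, leaving only the diagonal.
  have hprod : ∫ z, linearStatistic h z * linearStatistic g z ∂(gas Q n) =
      ∑ j : Fin n, ∑ k : Fin n, if j = k then
        gasMean (particleWeight Q n) j (fun z => h z * g z) else
        gasMean (particleWeight Q n) j h * gasMean (particleWeight Q n) k g := by
    rw [integral_gas hQ hn hM (hFh.mul hFg)]
    simp only [linearStatistic, Finset.sum_mul_sum]
    simp only [Finset.mul_sum]
    have hb : ∀ j k : Fin n, ∃ C, ∀ z : Fin n → ℂ, |h (z j) * g (z k)| ≤ C := fun j k =>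
      ⟨1, fun z => by
        rw [abs_mul]
        exact mul_le_one₀ (hh.abs_le_one _) (abs_nonneg _) (hg.abs_le_one _)⟩
    have hi : ∀ j k : Fin n, Integrable (fun z : Fin n → ℂ =>
        (∏ i, (‖z i‖ ^ (2 * (i : ℕ)) * particleWeight Q n (z i))) * (h (z j) * g (z k))) :=
      fun j k => hω.integrable_prod ((hh.measurable.comp (measurable_pi_apply j)).mul
        (hg.measurable.comp (measurable_pi_apply k))) (hb j k)
    rw [integral_finsetSum _ fun j _ => integrable_finsetSum _ fun k _ => hi j k, Finset.mul_sum]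
    refine Finset.sum_congr rfl fun j _ => ?_
    rw [integral_finsetSum _ fun k _ => hi j k, Finset.mul_sum]
    refine Finset.sum_congr rfl fun k _ => ?_
    split_ifs with hjk
    · subst hjk
      rw [integral_single_gas hMn j fun z => h z * g z,
        inv_mul_cancel_left₀ (Finset.prod_pos fun i _ => hM i).ne']
    · rw [integral_pair_gas hMn hjk,
        inv_mul_cancel_left₀ (Finset.prod_pos fun i _ => hM i).ne']
  rw [covariance_eq_sub (hFh.memLp _) (hFg.memLp _)]
  have : ∫ z, (linearStatistic h * linearStatistic g : (Fin n → ℂ) → ℝ) z ∂(gas Q n) =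
      ∫ z, linearStatistic h z * linearStatistic g z ∂(gas Q n) := rfl
  rw [this, hprod, integral_linearStatistic hQ hn hM hh, integral_linearStatistic hQ hn hM hg,
    Finset.sum_mul_sum, ← Finset.sum_sub_distrib]
  refine Finset.sum_congr rfl fun j _ => ?_
  rw [← Finset.sum_sub_distrib, Finset.sum_eq_single j]
  · simp
  · intro k _ hk
    simp [hk.symm]
  · simp

end Moments

/-! ### Radial profiles -/

section Profile

/-- Sums over reversed indices converge under a geometric domination. -/
lemma tendsto_sum_reflect {f : ℕ → ℕ → ℝ} {L : ℕ → ℝ} {C l : ℝ} (hl0 : 0 ≤ l) (hl1 : l < 1)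
    (hlim : ∀ i, Tendsto (fun n => f n (n - 1 - i)) atTop (𝓝 (L i)))
    (hbd : ∀ᶠ n : ℕ in atTop, ∀ i, i < n → |f n (n - 1 - i)| ≤ C * l ^ i) :
    Summable L ∧ Tendsto (fun n : ℕ => ∑ j : Fin n, f n j) atTop (𝓝 (∑' i, L i)) := by
  have hgeo : Summable fun i => C * l ^ i := (summable_geometric_of_lt_one hl0 hl1).mul_left C
  have hLb : ∀ i, |L i| ≤ C * l ^ i := by
    intro i
    refine le_of_tendsto (hlim i).abs ?_
    filter_upwards [hbd, eventually_gt_atTop i] with n hn hi using hn i hi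
  refine ⟨Summable.of_norm_bounded hgeo hLb, ?_⟩
  have hC : 0 ≤ C := by simpa using (abs_nonneg _).trans (hLb 0)
  -- Extension by zero to `i ≥ n`, where `n - 1 - i` would be truncated, turns the reversed sum into
  -- a series over a fixed index set.
  have key := tendsto_tsum_of_dominated_convergence (𝓕 := atTop)
    (f := fun n i => if i < n then f n (n - 1 - i) else 0) (g := L) hgeo
    (fun i => by
      refine (hlim i).congr' ?_
      filter_upwards [eventually_gt_atTop i] with n hn
      simp [hn])
    (by
      filter_upwards [hbd] with n hn i
      split_ifs with h
      · exact hn i h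
      · rw [norm_zero]
        positivity)
  refine key.congr fun n => ?_
  rw [tsum_eq_sum (s := Finset.range n) (by
    intro i hi
    simp only [Finset.mem_range] at hi
    simp [hi]), Fin.sum_univ_eq_sum_range (fun j => f n j), ← Finset.sum_range_reflect (fun j => f n j)]
  refine Finset.sum_congr rfl fun i hi => ?_
  rw [if_pos (Finset.mem_range.1 hi)]

/-! ### The radial cutoffs. -/

lemma continuous_bump (ε t : ℝ) : Continuous (bump ε t) := by
  unfold bump
  exact (Real.smoothTransition.continuous.comp (by fun_prop)).mul
    (Real.smoothTransition.continuous.comp (by fun_prop))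

lemma bump_nonneg (ε t : ℝ) (z : ℂ) : 0 ≤ bump ε t z :=
  mul_nonneg (Real.smoothTransition.nonneg _) (Real.smoothTransition.nonneg _)

lemma bump_le_one (ε t : ℝ) (z : ℂ) : bump ε t z ≤ 1 :=
  mul_le_one₀ (Real.smoothTransition.le_one _) (Real.smoothTransition.nonneg _)
    (Real.smoothTransition.le_one _)

lemma bump_eq_one {ε t : ℝ} (hε : 0 < ε) {z : ℂ} (hz : ‖z‖ = t) : bump ε t z = 1 := by
  have h1 : (1 : ℝ) ≤ (‖z‖ - (t - ε)) / (ε / 2) := by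
    rw [hz, one_le_div (by positivity)]
    linarith
  have h2 : (1 : ℝ) ≤ ((t + ε) - ‖z‖) / (ε / 2) := by
    rw [hz, one_le_div (by positivity)]
    linarith
  rw [bump, Real.smoothTransition.one_of_one_le h1, Real.smoothTransition.one_of_one_le h2, one_mul]

lemma bump_eq_zero {ε t : ℝ} (hε : 0 < ε) {z : ℂ} (hz : ε ≤ |‖z‖ - t|) : bump ε t z = 0 := by
  rcases le_abs.1 hz with h | h
  · have : ((t + ε) - ‖z‖) / (ε / 2) ≤ 0 := div_nonpos_of_nonpos_of_nonneg (by linarith) (by linarith)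
    rw [bump, Real.smoothTransition.zero_of_nonpos this, mul_zero]
  · have : (‖z‖ - (t - ε)) / (ε / 2) ≤ 0 := div_nonpos_of_nonpos_of_nonneg (by linarith) (by linarith)
    rw [bump, Real.smoothTransition.zero_of_nonpos this, zero_mul]

lemma isRadialTest_bump (ε t : ℝ) : IsRadialTest (bump ε t) :=
  ⟨(continuous_bump ε t).measurable,
    fun z => by rw [abs_of_nonneg (bump_nonneg ε t z)]; exact bump_le_one ε t z,
    fun z w h => by rw [bump, bump, h]⟩

lemma IsRadialTest.mul {h g : ℂ → ℝ} (hh : IsRadialTest h) (hg : IsRadialTest g) :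
    IsRadialTest (fun z => h z * g z) :=
  ⟨hh.measurable.mul hg.measurable,
    fun z => by
      rw [abs_mul]
      exact mul_le_one₀ (hh.abs_le_one z) (abs_nonneg _) (hg.abs_le_one z),
    fun z w h => by rw [hh.radial z w h, hg.radial z w h]⟩

/-- The normalized radial weight `r² e^{-Q(r)} / A`. -/
def profile (Q : ℂ → EReal) (A : ℝ) (r : ℝ) : ℝ := r ^ 2 * boltzmann Q r / A

/-- The radial integrals `∫ h(r) r^{-(2i+1)} (r² e^{-Q(r)} / A)ⁿ dr`. -/
def profileIntegral (Q : ℂ → EReal) (A : ℝ) (n i : ℕ) (h : ℂ → ℝ) : ℝ :=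
  ∫ r in Set.Ioi (0 : ℝ), (h r * (r ^ (2 * i + 1))⁻¹) * profile Q A r ^ n

variable {Q : ℂ → EReal} {A : ℝ}

/-- With the Jacobian `r`, the power is `r^{2(n-1-i)+1} = r^{2n} r^{-(2i+1)}`. Counting from the top
thus isolates a factor independent of `n` times an `n`-th power, the form required by Laplace's
method. -/
lemma radial_weight_eq (hA : 0 < A) {n i : ℕ} (hi : i < n) (h : ℂ → ℝ) {r : ℝ} (hr : 0 < r) :
    r * (r ^ (2 * (n - 1 - i)) * particleWeight Q n r * h r) =
      (A ^ n / Real.pi) * ((h r * (r ^ (2 * i + 1))⁻¹) * profile Q A r ^ n) := by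
  have hπ := Real.pi_pos.ne'
  obtain ⟨k, rfl⟩ : ∃ k, n = k + i + 1 := ⟨n - 1 - i, by omega⟩
  have e : k + i + 1 - 1 - i = k := by omega
  rw [e, particleWeight, profile, div_pow, mul_pow]
  field_simp
  ring

lemma IsRadialTest.eq_norm {h : ℂ → ℝ} (hh : IsRadialTest h) (z : ℂ) : h z = h ((‖z‖ : ℝ) : ℂ) :=
  hh.radial _ _ (by simp)

/-- Polar coordinates; the prefactor does not depend on `h` and cancels in `gasMean_eq`. -/
lemma integral_moment_eq (hQ : IsAdmissible Q) (hA : 0 < A) {n i : ℕ} (hi : i < n) {h : ℂ → ℝ}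
    (hh : IsRadialTest h) :
    ∫ z : ℂ, ‖z‖ ^ (2 * (n - 1 - i)) * particleWeight Q n z * h z =
      (2 * volume.real (Metric.ball (0 : ℂ) 1)) * ((A ^ n / Real.pi) * profileIntegral Q A n i h) := by
  have hω := hQ.isGasWeight (by omega : 0 < n)
  have h1 : ∀ z : ℂ, ‖z‖ ^ (2 * (n - 1 - i)) * particleWeight Q n z * h z =
      (fun r : ℝ => r ^ (2 * (n - 1 - i)) * particleWeight Q n r * h r) ‖z‖ := fun z => by
    simp only
    rw [← hh.eq_norm z, ← hω.radial z ((‖z‖ : ℝ) : ℂ) (by simp)]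
  simp only [h1]
  have := integral_fun_norm_addHaar (volume : Measure ℂ)
    (fun r : ℝ => r ^ (2 * (n - 1 - i)) * particleWeight Q n r * h r)
  rw [this, Complex.finrank_real_complex, profileIntegral, ← integral_const_mul]
  simp only [smul_eq_mul, nsmul_eq_mul, Nat.cast_ofNat, ← mul_assoc]
  congr 1
  refine setIntegral_congr_fun measurableSet_Ioi fun r hr => ?_
  have := radial_weight_eq (Q := Q) hA hi h hr
  simp only [← mul_assoc] at this ⊢
  simpa using this

lemma isRadialTest_one : IsRadialTest fun _ => 1 :=
  ⟨measurable_const, fun _ => by simp, fun _ _ _ => rfl⟩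

lemma gasMean_eq (hQ : IsAdmissible Q) (hA : 0 < A) {n i : ℕ} (hi : i < n) {h : ℂ → ℝ}
    (hh : IsRadialTest h) :
    gasMean (particleWeight Q n) (n - 1 - i) h =
      profileIntegral Q A n i h / profileIntegral Q A n i fun _ => 1 := by
  have h1 := integral_moment_eq hQ hA hi hh
  have h2 := integral_moment_eq hQ hA hi isRadialTest_one
  simp only [mul_one] at h2
  have hv : volume.real (Metric.ball (0 : ℂ) 1) ≠ 0 := by
    refine (ENNReal.toReal_pos ?_ ?_).ne'
    · exact (Metric.measure_ball_pos volume 0 one_pos).ne'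
    · exact measure_ball_lt_top.ne
  have hA' : A ^ n / Real.pi ≠ 0 := by
    have := Real.pi_pos
    positivity
  rw [gasMean, gasMoment, h1, h2, mul_div_mul_left _ _ (mul_ne_zero two_ne_zero hv),
    mul_div_mul_left _ _ hA']

lemma integrableOn_profile (hQ : IsAdmissible Q) (hA : 0 < A) {n i : ℕ} (hi : i < n) {h : ℂ → ℝ}
    (hh : IsRadialTest h) :
    IntegrableOn (fun r : ℝ => (h r * (r ^ (2 * i + 1))⁻¹) * profile Q A r ^ n) (Set.Ioi 0) := by
  have hω := hQ.isGasWeight (by omega : 0 < n)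
  have h0 : Integrable (fun z : ℂ => ‖z‖ ^ (2 * (n - 1 - i)) * particleWeight Q n z * h z) :=
    (hω.integrable _ (by omega)).mul_bdd (c := 1) hh.measurable.aestronglyMeasurable
      (Eventually.of_forall hh.abs_le_one)
  have h1 : ∀ z : ℂ, ‖z‖ ^ (2 * (n - 1 - i)) * particleWeight Q n z * h z =
      (fun r : ℝ => r ^ (2 * (n - 1 - i)) * particleWeight Q n r * h r) ‖z‖ := fun z => by
    simp only
    rw [← hh.eq_norm z, ← hω.radial z ((‖z‖ : ℝ) : ℂ) (by simp)]
  simp only [h1] at h0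
  have h2 := (integrable_fun_norm_addHaar (volume : Measure ℂ)
    (f := fun r : ℝ => r ^ (2 * (n - 1 - i)) * particleWeight Q n r * h r)).1 h0
  rw [Complex.finrank_real_complex] at h2
  have hA' : A ^ n / Real.pi ≠ 0 := by
    have := Real.pi_pos
    positivity
  have h3 : IntegrableOn (fun r : ℝ => (A ^ n / Real.pi) *
      ((h r * (r ^ (2 * i + 1))⁻¹) * profile Q A r ^ n)) (Set.Ioi 0) := by
    refine h2.congr_fun (fun r hr => ?_) measurableSet_Ioi
    have := radial_weight_eq (Q := Q) hA hi h hr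
    simpa using this
  exact (integrable_const_mul_iff (IsUnit.mk0 _ hA') _).1 h3

lemma measurable_profile (hQ : IsAdmissible Q) : Measurable (profile Q A) := by
  have := hQ.measurable_boltzmann.comp Complex.measurable_ofReal
  exact ((measurable_id.pow_const 2).mul this).div_const A

lemma profile_nonneg (hA : 0 < A) (r : ℝ) : 0 ≤ profile Q A r :=
  div_nonneg (mul_nonneg (sq_nonneg r) (boltzmann_nonneg _)) hA.le

/-- Away from its maxima the profile is bounded by a constant less than `1`. -/
lemma profile_tail (hQ : IsAdmissible Q) (hA : 0 < A) {ι : Type*} {s : ι → ℝ}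
    (hmax : ∀ x : ℝ, 0 ≤ x → x ^ 2 * boltzmann Q x ≤ A)
    (huniq : ∀ x : ℝ, 0 ≤ x → x ^ 2 * boltzmann Q x = A → ∃ i, x = s i) {δ : ℝ} (hδ : 0 < δ) :
    ∃ θ : ℝ, 0 ≤ θ ∧ θ < 1 ∧ ∀ x : ℝ, 0 < x → (∀ i, δ ≤ |x - s i|) → profile Q A x ≤ θ := by
  obtain ⟨a, ha, R, hR, hfar⟩ := hQ.exists_boltzmann_le_rpow
  have hlim : Tendsto (fun x : ℝ => x ^ (-(2 * a - 2)) / A) atTop (𝓝 (0 / A)) :=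
    (tendsto_rpow_neg_atTop (by linarith)).div_const A
  rw [zero_div] at hlim
  obtain ⟨T, hT⟩ := eventually_atTop.1 (hlim.eventually_lt_const (show (0 : ℝ) < 1 / 2 by norm_num))
  set S := max R T with hS
  have hlarge : ∀ x, S ≤ x → profile Q A x ≤ 1 / 2 := by
    intro x hx
    have hxR : R ≤ x := (le_max_left _ _).trans hx
    have hx0 : 0 < x := by linarith
    refine le_trans ?_ (hT x ((le_max_right _ _).trans hx)).le
    refine div_le_div_of_nonneg_right ?_ hA.le
    have h1 : boltzmann Q x ≤ x ^ (-(2 * a)) := by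
      have := hfar (x : ℂ) (by simpa [abs_of_pos hx0] using hxR)
      simpa [abs_of_pos hx0] using this
    calc x ^ 2 * boltzmann Q x ≤ x ^ (2 : ℝ) * x ^ (-(2 * a)) := by
          rw [Real.rpow_two]
          exact mul_le_mul_of_nonneg_left h1 (sq_nonneg x)
      _ = x ^ (-(2 * a - 2)) := by rw [← Real.rpow_add hx0]; congr 1; ring
  -- What remains is a compact set without maximizers, on which an upper semicontinuous function
  -- attains a maximum, necessarily below `A`.
  set K : Set ℝ := Set.Icc 0 S ∩ {x | ∀ i, δ ≤ |x - s i|} with hK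
  have hKc : IsCompact K := by
    refine isCompact_Icc.inter_right ?_
    have : {x : ℝ | ∀ i, δ ≤ |x - s i|} = ⋂ i, {x | δ ≤ |x - s i|} := by
      ext x
      simp
    rw [this]
    exact isClosed_iInter fun i => isClosed_le continuous_const (by fun_prop)
  by_cases hne : K.Nonempty
  · have husc : UpperSemicontinuousOn (fun x : ℝ => x ^ 2 * boltzmann Q x) K :=
      upperSemicontinuousOn_mul (continuous_pow 2).continuousOn (fun x _ => sq_nonneg x)
        ((hQ.upperSemicontinuous_boltzmann.comp Complex.continuous_ofReal).upperSemicontinuousOn _)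
    obtain ⟨y, hy, hym⟩ := husc.exists_isMaxOn hne hKc
    have hylt : profile Q A y < 1 := by
      rw [profile, div_lt_one hA]
      refine lt_of_le_of_ne (hmax y hy.1.1) fun h => ?_
      obtain ⟨i, hi⟩ := huniq y hy.1.1 h
      have := hy.2 i
      rw [hi, sub_self, abs_zero] at this
      linarith
    refine ⟨max (1 / 2) (profile Q A y), le_max_of_le_left (by norm_num),
      max_lt (by norm_num) hylt, fun x hx hxs => ?_⟩
    rcases le_total x S with h | h
    · refine le_trans ?_ (le_max_right _ _)
      exact div_le_div_of_nonneg_right (hym (show x ∈ K from ⟨⟨hx.le, h⟩, hxs⟩)) hA.le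
    · exact (hlarge x h).trans (le_max_left _ _)
  · refine ⟨1 / 2, by norm_num, by norm_num, fun x hx hxs => ?_⟩
    rcases le_total x S with h | h
    · exact absurd ⟨x, ⟨hx.le, h⟩, hxs⟩ hne
    · exact hlarge x h

end Profile

/-! ### Asymptotics of the radial means -/

section RadialMeans

variable {Q : ℂ → EReal} {A : ℝ}

/-- The function `r² e^{-Q(r)}` attains its maximum `A` exactly at the points `s i`, and these maxima
are nondegenerate. -/
structure HasNondegenerateMaxima {ι : Type*} (Q : ℂ → EReal) (A : ℝ) (s : ι → ℝ) : Prop where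
  pos : 0 < A
  le : ∀ x : ℝ, 0 ≤ x → x ^ 2 * boltzmann Q x ≤ A
  eq_iff : ∀ x : ℝ, 0 ≤ x → (x ^ 2 * boltzmann Q x = A ↔ ∃ i, x = s i)
  injective : Function.Injective s
  point_pos : ∀ i, 0 < s i
  mem : ∀ i, (s i : ℂ) ∈ coincidenceSet Q
  laplacian_pos : ∀ i, 0 < quarterLaplacian Q (s i : ℂ)

/-- The width of the Gaussian approximation at radius `r`. -/
def gaussianWidth (Q : ℂ → EReal) (r : ℝ) : ℝ :=
  Real.sqrt (2 * Real.pi / (4 * quarterLaplacian Q (r : ℂ)))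

/-- The asymptotic mass near radius `r` in the `i`-th integral from the top. -/
def laplaceMass (Q : ℂ → EReal) (i : ℕ) (r : ℝ) : ℝ := (r ^ (2 * i + 1))⁻¹ * gaussianWidth Q r

namespace HasNondegenerateMaxima

variable {ι : Type*} {s : ι → ℝ}

lemma gaussianWidth_pos (H : HasNondegenerateMaxima Q A s) (k : ι) : 0 < gaussianWidth Q (s k) := by
  have := H.laplacian_pos k
  have := Real.pi_pos
  exact Real.sqrt_pos.2 (by positivity)

lemma laplaceMass_pos (H : HasNondegenerateMaxima Q A s) (i : ℕ) (k : ι) :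
    0 < laplaceMass Q i (s k) := by
  have := H.gaussianWidth_pos k
  have := H.point_pos k
  unfold laplaceMass
  positivity

lemma tendsto_sqrt_mul_integral [Fintype ι] (hQ : IsAdmissible Q) (H : HasNondegenerateMaxima Q A s)
    {g : ℝ → ℝ} (hgm : Measurable g) (hg : ∀ k, ContinuousAt g (s k)) {n₀ : ℕ}
    (hint : IntegrableOn (fun x => g x * profile Q A x ^ n₀) (Set.Ioi 0)) :
    Tendsto (fun n : ℕ => Real.sqrt n * ∫ x in Set.Ioi 0, g x * profile Q A x ^ n) atTop
      (𝓝 (∑ k, g (s k) * gaussianWidth Q (s k))) := by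
  refine tendsto_laplace (measurable_profile hQ) hgm (profile_nonneg H.pos)
    (fun x hx => (div_le_one H.pos).2 (H.le x hx.le)) H.injective H.point_pos
    (κ := fun k => 4 * quarterLaplacian Q (s k : ℂ))
    (fun k => mul_pos four_pos (H.laplacian_pos k)) hg (fun k => ?_) ?_ hint
  · exact hQ.exists_expansion H.pos (H.point_pos k) (H.mem k) H.le
      ((H.eq_iff _ (H.point_pos k).le).2 ⟨k, rfl⟩)
  · exact fun δ hδ => profile_tail hQ H.pos H.le (fun x hx => (H.eq_iff x hx).1) hδ

lemma tendsto_profileIntegral [Fintype ι] (hQ : IsAdmissible Q) (H : HasNondegenerateMaxima Q A s)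
    {h : ℂ → ℝ} (hh : IsRadialTest h) (hc : Continuous h) (i : ℕ) :
    Tendsto (fun n : ℕ => Real.sqrt n * profileIntegral Q A n i h) atTop
      (𝓝 (∑ k, h (s k) * laplaceMass Q i (s k))) := by
  have := tendsto_sqrt_mul_integral hQ H (g := fun r : ℝ => h r * (r ^ (2 * i + 1))⁻¹) ?_ ?_
    -- The exponent `n₀ = i + 1` is the first for which the `i`-th index from the top exists, hence
    -- the first with guaranteed integrability at `0`.
    (integrableOn_profile hQ H.pos (Nat.lt_succ_self i) hh)
  · simpa only [profileIntegral, laplaceMass, mul_assoc] using this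
  · exact (hh.measurable.comp Complex.measurable_ofReal).mul
      (Measurable.inv (measurable_id.pow_const _))
  · intro k
    refine ContinuousAt.mul (by fun_prop) (ContinuousAt.inv₀ (by fun_prop) ?_)
    exact (pow_pos (H.point_pos k) _).ne'

lemma tendsto_gasMean [Fintype ι] [Nonempty ι] (hQ : IsAdmissible Q) (H : HasNondegenerateMaxima Q A s)
    {h : ℂ → ℝ} (hh : IsRadialTest h) (hc : Continuous h) (i : ℕ) :
    Tendsto (fun n : ℕ => gasMean (particleWeight Q n) (n - 1 - i) h) atTop
      (𝓝 ((∑ k, h (s k) * laplaceMass Q i (s k)) / ∑ k, laplaceMass Q i (s k))) := by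
  have h1 := tendsto_profileIntegral hQ H hh hc i
  have h2 := tendsto_profileIntegral hQ H isRadialTest_one continuous_const i
  simp only [one_mul] at h2
  have hpos : 0 < ∑ k, laplaceMass Q i (s k) :=
    Finset.sum_pos (fun k _ => H.laplaceMass_pos i k) Finset.univ_nonempty
  refine (h1.div h2 hpos.ne').congr' ?_
  filter_upwards [eventually_gt_atTop i] with n hn
  have hn0 : (0 : ℝ) < n := by exact_mod_cast (by omega : 0 < n)
  rw [gasMean_eq hQ H.pos hn hh, Pi.div_apply, mul_div_mul_left _ _ (Real.sqrt_pos.2 hn0).ne']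

lemma integrableOn_test (hQ : IsAdmissible Q) (H : HasNondegenerateMaxima Q A s) {φ : ℂ → ℝ}
    (hφ : IsRadialTest φ) {r₂ : ℝ} (hr₂ : ∀ z, r₂ ≤ ‖z‖ → φ z = 0) (n : ℕ) :
    IntegrableOn (fun x : ℝ => φ x * profile Q A x ^ n) (Set.Ioi 0) := by
  have hm : Measurable fun x : ℝ => φ x := hφ.measurable.comp Complex.measurable_ofReal
  refine integrableOn_mul_pow (n₀ := 0) (measurable_profile hQ) hm (profile_nonneg H.pos)
    (fun x hx => (div_le_one H.pos).2 (H.le x hx.le)) ?_ (Nat.zero_le n)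
  simp only [pow_zero, mul_one]
  have hconst : IntegrableOn (fun _ : ℝ => (1 : ℝ)) (Set.Ioo 0 (max r₂ 0)) :=
    integrableOn_const (by simp)
  have h1 : IntegrableOn (fun x : ℝ => φ x) (Set.Ioo 0 (max r₂ 0)) :=
    Integrable.mono hconst hm.aestronglyMeasurable
      (Eventually.of_forall fun x => by simpa using hφ.abs_le_one x)
  refine IntegrableOn.of_forall_sdiff_eq_zero h1 measurableSet_Ioi fun x hx => hr₂ _ ?_
  have hx0 : 0 < x := hx.1
  have : ¬ x < max r₂ 0 := fun h => hx.2 ⟨hx0, h⟩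
  rw [Complex.norm_real, Real.norm_of_nonneg hx0.le]
  exact (le_max_left _ _).trans (not_lt.1 this)

/-- `φ` lives beyond `r₁`, whereas the normalization contains the mass near `s k`, inside `r' < r₁`.
Bounding `r^{-(2i+1)}` by its values at `r₁` and `r'` costs a factor `(r'/r₁)^{2i+1}` and leaves a
quotient `N / D` without `i`, which converges by Laplace's method. Hence the uniformity over all `i
< n`, where the pointwise limits in `i` say nothing. -/
lemma exists_gasMean_le [Fintype ι] (hQ : IsAdmissible Q) (H : HasNondegenerateMaxima Q A s)
    (k : ι)
    {φ : ℂ → ℝ} (hφ : IsRadialTest φ) (hφc : Continuous φ) (hφ0 : ∀ z, 0 ≤ φ z) {r₁ r₂ : ℝ}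
    (hr₁ : s k < r₁) (hφ1 : ∀ z, ‖z‖ ≤ r₁ → φ z = 0) (hφ2 : ∀ z, r₂ ≤ ‖z‖ → φ z = 0) :
    ∃ C l : ℝ, 0 ≤ C ∧ 0 ≤ l ∧ l < 1 ∧ ∀ᶠ n : ℕ in atTop, ∀ i, i < n →
      |gasMean (particleWeight Q n) (n - 1 - i) φ| ≤ C * l ^ i := by
  obtain ⟨r', hr1, hr2⟩ := exists_between hr₁
  have hsk := H.point_pos k
  have hr'0 : 0 < r' := hsk.trans hr1
  have hr₁0 : 0 < r₁ := hr'0.trans hr2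
  have hδ : 0 < r' - s k := sub_pos.2 hr1
  -- A cutoff supported in `‖z‖ ≤ r'` and equal to `1` at radius `s k`, so that the limit `LD` of
  -- the rescaled denominator is positive.
  set β : ℂ → ℝ := bump (r' - s k) (s k) with hβ
  have hβt : IsRadialTest β := isRadialTest_bump _ _
  have hβ2 : ∀ z, r' ≤ ‖z‖ → β z = 0 := fun z hz =>
    bump_eq_zero hδ ((sub_le_sub_right hz _).trans (le_abs_self _))
  have hiφ := fun n => integrableOn_test hQ H hφ hφ2 n
  have hiβ := fun n => integrableOn_test hQ H hβt hβ2 n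
  have hm : ∀ {ψ : ℂ → ℝ}, IsRadialTest ψ → Measurable fun x : ℝ => ψ x := fun hψ =>
    hψ.measurable.comp Complex.measurable_ofReal
  have hN := tendsto_sqrt_mul_integral hQ H (hm hφ)
    (fun k => (hφc.comp Complex.continuous_ofReal).continuousAt) (hiφ 0)
  have hD := tendsto_sqrt_mul_integral hQ H (hm hβt)
    (fun k => ((continuous_bump _ _).comp Complex.continuous_ofReal).continuousAt) (hiβ 0)
  set LN := ∑ k, φ (s k) * gaussianWidth Q (s k) with hLN
  set LD := ∑ k, β (s k) * gaussianWidth Q (s k) with hLD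
  have hLDpos : 0 < LD := by
    have h1 : β (s k) * gaussianWidth Q (s k) ≤ LD :=
      Finset.single_le_sum (f := fun k => β (s k) * gaussianWidth Q (s k))
        (fun j _ => mul_nonneg (bump_nonneg _ _ _) (H.gaussianWidth_pos j).le) (Finset.mem_univ k)
    have h2 : β (s k) = 1 := bump_eq_one hδ (by simp [abs_of_pos hsk])
    rw [h2, one_mul] at h1
    exact (H.gaussianWidth_pos k).trans_le h1
  have hLN0 : 0 ≤ LN :=
    Finset.sum_nonneg fun j _ => mul_nonneg (hφ0 _) (H.gaussianWidth_pos j).le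
  have hq : 0 ≤ r' / r₁ := by positivity
  have hq1 : r' / r₁ < 1 := (div_lt_one hr₁0).2 hr2
  refine ⟨LN / LD + 1, (r' / r₁) ^ 2, by positivity, by positivity,
    pow_lt_one₀ hq hq1 two_ne_zero, ?_⟩
  filter_upwards [(hN.div hD hLDpos.ne').eventually_lt_const (lt_add_one (LN / LD)),
    hD.eventually_const_lt hLDpos, eventually_gt_atTop 0] with n hn1 hn2 hn3 i hi
  have hsn : 0 < Real.sqrt n := Real.sqrt_pos.2 (by exact_mod_cast hn3)
  set N := ∫ x in Set.Ioi (0 : ℝ), φ x * profile Q A x ^ n with hNdef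
  set D := ∫ x in Set.Ioi (0 : ℝ), β x * profile Q A x ^ n with hDdef
  have hDpos : 0 < D := pos_of_mul_pos_right hn2 hsn.le
  rw [Pi.div_apply, mul_div_mul_left _ _ hsn.ne'] at hn1
  have hE0 : ∀ x, 0 ≤ profile Q A x ^ n := fun x => pow_nonneg (profile_nonneg H.pos x) n
  have hnum : profileIntegral Q A n i φ ≤ (r₁ ^ (2 * i + 1))⁻¹ * N := by
    rw [hNdef, ← integral_const_mul]
    refine setIntegral_mono_on (integrableOn_profile hQ H.pos hi hφ) ((hiφ n).const_mul _)
      measurableSet_Ioi fun x hx => ?_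
    have hx0 : 0 < x := hx
    rcases le_total x r₁ with h | h
    · rw [hφ1 x (by simpa [abs_of_pos hx0] using h)]
      simp
    · have h1 : (x ^ (2 * i + 1))⁻¹ ≤ (r₁ ^ (2 * i + 1))⁻¹ :=
        inv_anti₀ (by positivity) (pow_le_pow_left₀ hr₁0.le h _)
      calc φ x * (x ^ (2 * i + 1))⁻¹ * profile Q A x ^ n
          = (x ^ (2 * i + 1))⁻¹ * (φ x * profile Q A x ^ n) := by ring
        _ ≤ _ := mul_le_mul_of_nonneg_right h1 (mul_nonneg (hφ0 _) (hE0 x))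
  have hden : (r' ^ (2 * i + 1))⁻¹ * D ≤ profileIntegral Q A n i fun _ => 1 := by
    rw [hDdef, ← integral_const_mul]
    refine setIntegral_mono_on ((hiβ n).const_mul _)
      (integrableOn_profile hQ H.pos hi isRadialTest_one) measurableSet_Ioi fun x hx => ?_
    have hx0 : 0 < x := hx
    rw [one_mul]
    rcases le_total r' x with h | h
    · rw [hβ2 x (by simpa [abs_of_pos hx0] using h)]
      have := hE0 x
      simp only [zero_mul, mul_zero]
      positivity
    · have h1 : (r' ^ (2 * i + 1))⁻¹ ≤ (x ^ (2 * i + 1))⁻¹ :=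
        inv_anti₀ (by positivity) (pow_le_pow_left₀ hx0.le h _)
      calc (r' ^ (2 * i + 1))⁻¹ * (β x * profile Q A x ^ n)
          ≤ (x ^ (2 * i + 1))⁻¹ * (1 * profile Q A x ^ n) := by
            refine mul_le_mul h1 (mul_le_mul_of_nonneg_right (bump_le_one _ _ _) (hE0 x))
              (mul_nonneg (bump_nonneg _ _ _) (hE0 x)) (by positivity)
        _ = _ := by rw [one_mul]
  have hnum0 : 0 ≤ profileIntegral Q A n i φ := by
    refine setIntegral_nonneg measurableSet_Ioi fun x hx => ?_
    have hx0 : 0 < x := hx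
    have := hE0 x
    have := hφ0 x
    positivity
  have hdpos : 0 < (r' ^ (2 * i + 1))⁻¹ * D := by positivity
  rw [gasMean_eq hQ H.pos hi hφ, abs_of_nonneg (div_nonneg hnum0 (hdpos.le.trans hden))]
  have hN0 : 0 ≤ N := setIntegral_nonneg measurableSet_Ioi fun x _ => mul_nonneg (hφ0 _) (hE0 x)
  calc profileIntegral Q A n i φ / profileIntegral Q A n i (fun _ => 1)
      ≤ ((r₁ ^ (2 * i + 1))⁻¹ * N) / ((r' ^ (2 * i + 1))⁻¹ * D) :=
        div_le_div₀ (by positivity) hnum hdpos hden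
    _ = (N / D) * (r' / r₁) ^ (2 * i + 1) := by
        rw [div_pow]
        field_simp
    _ ≤ (LN / LD + 1) * ((r' / r₁) ^ 2) ^ i := by
        refine mul_le_mul hn1.le ?_ (by positivity) (by positivity)
        rw [← pow_mul]
        exact pow_le_pow_of_le_one hq hq1.le (by omega)

end HasNondegenerateMaxima

end RadialMeans

/-! ### Limits of the counts at the outposts -/

section Counts

variable {Q : ℂ → EReal} {m : ℕ} {a₀ b₀ : ℝ} {t : Fin m → ℝ}

/-- The radii of the outer boundary of the droplet and of the outposts. -/
def contactRadius (b₀ : ℝ) (t : Fin m → ℝ) (o : Option (Fin m)) : ℝ := o.elim b₀ t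

lemma HasOuterOutposts.exists_hasNondegenerateMaxima (hS : HasOuterOutposts Q a₀ b₀ t)
    (hQ : IsAdmissible Q) (hb : 0 < quarterLaplacian Q (b₀ : ℂ))
    (ht : ∀ k, 0 < quarterLaplacian Q (t k : ℂ)) :
    ∃ A, HasNondegenerateMaxima Q A (contactRadius b₀ t) := by
  have hb0 : 0 < b₀ := hS.nonneg.trans_lt hS.lt
  obtain ⟨A, hA, hle, hiff⟩ := exists_max_sq_mul_boltzmann hQ hS hb
  have hpos : ∀ o, 0 < contactRadius b₀ t o := by
    rintro (_ | k)
    · exact hb0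
    · exact hb0.trans (hS.lt_outpost k)
  refine ⟨A, hA, hle, fun x hx => ?_, ?_, hpos, fun o => ?_, ?_⟩
  · rw [hiff x hx, Option.exists]
    rfl
  · rintro (_ | k) (_ | l) h
    · rfl
    · exact absurd h (hS.lt_outpost l).ne
    · exact absurd h (hS.lt_outpost k).ne'
    · exact congrArg some (hS.strictMono.injective h)
  · rw [ofReal_mem_coincidenceSet_iff hS (hpos o).le]
    rcases o with _ | k
    · exact Or.inl ⟨hS.lt.le, le_rfl⟩
    · exact Or.inr ⟨k, rfl⟩
  · rintro (_ | k)
    · exact hb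
    · exact ht k

lemma heineDenom_pos (hb0 : 0 < b₀) (htp : ∀ k, 0 < t k) (j : ℕ) : 0 < heineDenom Q b₀ t j := by
  have : 0 ≤ ∑ k, theta Q b₀ (t k) * rho b₀ (t k) ^ (2 * j + 1) :=
    Finset.sum_nonneg fun k _ => mul_nonneg (Real.sqrt_nonneg _)
      (pow_nonneg (div_nonneg hb0.le (htp k).le) _)
  unfold heineDenom
  linarith

/-- The Gaussian widths have ratio `√(ΔQ(b₀)/ΔQ(r)) = ϑ`, and the factors `r^{-(2i+1)}` have ratio
`ρ^{2i+1}`. The mass at `b₀` serves as the unit, which is the `1` in `heineDenom`. -/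
lemma laplaceMass_outpost (hb0 : 0 < b₀) {r : ℝ} (hr : 0 < r)
    (hb : 0 < quarterLaplacian Q (b₀ : ℂ)) (hrl : 0 < quarterLaplacian Q (r : ℂ)) (i : ℕ) :
    laplaceMass Q i r = laplaceMass Q i b₀ * (theta Q b₀ r * rho b₀ r ^ (2 * i + 1)) := by
  have hπ := Real.pi_pos
  have h1 : gaussianWidth Q r = gaussianWidth Q b₀ * theta Q b₀ r := by
    rw [gaussianWidth, gaussianWidth, theta, ← Real.sqrt_mul (by positivity)]
    congr 1
    field_simp
  rw [laplaceMass, laplaceMass, h1, rho, div_pow]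
  field_simp

lemma meanTerm_eq (H : HasNondegenerateMaxima Q A (contactRadius b₀ t)) (p : Fin m) (i : ℕ) :
    meanTerm Q b₀ t p i = laplaceMass Q i (t p) /
      ∑ o, laplaceMass Q i (contactRadius b₀ t o) := by
  have hb0 : 0 < b₀ := H.point_pos none
  have htp : ∀ k, 0 < t k := fun k => H.point_pos (some k)
  have hm : ∀ k, laplaceMass Q i (t k) =
      laplaceMass Q i b₀ * (theta Q b₀ (t k) * rho b₀ (t k) ^ (2 * i + 1)) := fun k =>
    laplaceMass_outpost hb0 (htp k) (H.laplacian_pos none) (H.laplacian_pos (some k)) i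
  have hL : 0 < laplaceMass Q i b₀ := H.laplaceMass_pos i none
  have hsum : ∑ o, laplaceMass Q i (contactRadius b₀ t o) =
      laplaceMass Q i b₀ * heineDenom Q b₀ t i := by
    rw [Fintype.sum_option]
    simp only [contactRadius, Option.elim, hm, ← Finset.mul_sum, heineDenom]
    ring
  rw [hsum, hm p, mul_div_mul_left _ _ hL.ne', meanTerm]

section Bumps

variable {ε : ℝ}

lemma bump_mul_bump_eq_zero (hε : 0 < ε) (hsep : ∀ k l, k < l → t k + 2 * ε ≤ t l - 2 * ε)
    {p q : Fin m} (hpq : p ≠ q) (z : ℂ) : bump ε (t p) z * bump ε (t q) z = 0 := by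
  by_contra h
  have h1 : ¬ ε ≤ |‖z‖ - t p| := fun h' => left_ne_zero_of_mul h (bump_eq_zero hε h')
  have h2 : ¬ ε ≤ |‖z‖ - t q| := fun h' => right_ne_zero_of_mul h (bump_eq_zero hε h')
  rw [not_le, abs_lt] at h1 h2
  rcases lt_or_gt_of_ne hpq with h3 | h3
  · linarith [hsep p q h3]
  · linarith [hsep q p h3]

/-- On the contact radii the cutoff takes only the values `0` and `1`, so it and its square have the
same limiting mean. This is the source of the Bernoulli form of the variance. -/
lemma bump_contactRadius (hε : 0 < ε) (hsep : ∀ k l, k < l → t k + 2 * ε ≤ t l - 2 * ε)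
    (hdrop : ∀ k, b₀ < t k - ε) (hb0 : 0 < b₀) (p : Fin m) (o : Option (Fin m)) :
    bump ε (t p) (contactRadius b₀ t o : ℂ) = if o = some p then 1 else 0 := by
  have htp : ∀ k, 0 < t k := fun k => by linarith [hdrop k]
  rcases o with _ | k
  · refine bump_eq_zero hε ?_
    simp only [contactRadius, Option.elim, Complex.norm_real, Real.norm_of_nonneg hb0.le]
    exact le_trans (by linarith [hdrop p]) (neg_le_abs _)
  · have hn : ‖((contactRadius b₀ t (some k) : ℝ) : ℂ)‖ = t k := by
      simp [contactRadius, abs_of_pos (htp k)]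
    by_cases hkp : k = p
    · subst hkp
      simpa using bump_eq_one hε hn
    · have h1 := bump_mul_bump_eq_zero hε hsep hkp (contactRadius b₀ t (some k) : ℂ)
      rw [bump_eq_one hε hn, one_mul] at h1
      rw [h1, if_neg fun h => hkp (Option.some.inj h)]

end Bumps

/-- The limit of the mean of a radial function that is the indicator of one outpost on the contact
set. -/
lemma tendsto_gasMean_meanTerm (hQ : IsAdmissible Q)
    (H : HasNondegenerateMaxima Q A (contactRadius b₀ t)) {h : ℂ → ℝ} (hh : IsRadialTest h)
    (hc : Continuous h) (p : Fin m)
    (hval : ∀ o, h (contactRadius b₀ t o : ℂ) = if o = some p then 1 else 0) (i : ℕ) :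
    Tendsto (fun n : ℕ => gasMean (particleWeight Q n) (n - 1 - i) h) atTop
      (𝓝 (meanTerm Q b₀ t p i)) := by
  have h1 := H.tendsto_gasMean hQ hh hc i
  simp only [hval, ite_mul, one_mul, zero_mul, Finset.sum_ite_eq', Finset.mem_univ, if_true] at h1
  rw [meanTerm_eq H p i]
  exact h1

end Counts

end CoulombGas

end

/-! ### Summation over the radial modes. -/

theorem mainTheorem3 (Q : ℂ → EReal) (hQ : IsAdmissible Q)
    (m : ℕ) (a₀ b₀ : ℝ) (t : Fin m → ℝ) (hS : HasOuterOutposts Q a₀ b₀ t)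
    (hb : 0 < quarterLaplacian Q (b₀ : ℂ)) (ht : ∀ k, 0 < quarterLaplacian Q (t k : ℂ))
    (ε : ℝ) (hε : 0 < ε) (hsep : ∀ k l, k < l → t k + 2 * ε ≤ t l - 2 * ε)
    (hdrop : ∀ k, b₀ < t k - ε) :
    (∀ n : ℕ, 0 < n → IsProbabilityMeasure (gas Q n)) ∧
    (∀ p : Fin m,
      Summable (meanTerm Q b₀ t p) ∧
      Tendsto (fun n : ℕ => ∫ z, particleCount ε (t p) z ∂(gas Q n)) atTop
        (𝓝 (∑' j, meanTerm Q b₀ t p j))) ∧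
    (∀ p : Fin m,
      Summable (varTerm Q b₀ t p) ∧
      Tendsto (fun n : ℕ => variance (particleCount ε (t p)) (gas Q n)) atTop
        (𝓝 (∑' j, varTerm Q b₀ t p j))) ∧
    (∀ p q : Fin m, p ≠ q →
      Summable (covTerm Q b₀ t p q) ∧
      Tendsto
        (fun n : ℕ => covariance (particleCount ε (t p)) (particleCount ε (t q)) (gas Q n)) atTop
        (𝓝 (-∑' j, covTerm Q b₀ t p q j)) ∧
      -∑' j, covTerm Q b₀ t p q j < 0) := by
  obtain ⟨A, H⟩ := hS.exists_hasNondegenerateMaxima hQ hb ht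
  have hb0 : 0 < b₀ := H.point_pos none
  have htp : ∀ k, 0 < t k := fun k => H.point_pos (some k)
  have hM : ∀ {n : ℕ}, 0 < n → ∀ i : Fin n, 0 < gasMoment (particleWeight Q n) i := fun hn i =>
    hQ.gasMoment_pos hn (by exact_mod_cast hb0.ne') (H.mem none) i.isLt
  have hprob : ∀ n : ℕ, 0 < n → IsProbabilityMeasure (gas Q n) := fun n hn =>
    isProbabilityMeasure_gas hQ hn (hM hn)
  have htest : ∀ p : Fin m, IsRadialTest (bump ε (t p)) := fun p => isRadialTest_bump _ _
  have hcont : ∀ p : Fin m, Continuous (bump ε (t p)) := fun p => continuous_bump _ _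
  have hval := bump_contactRadius (b₀ := b₀) (t := t) hε hsep hdrop hb0
  have hD : ∀ i, 0 < heineDenom Q b₀ t i := heineDenom_pos hb0 htp
  have hlim : ∀ p i, Tendsto
      (fun n : ℕ => gasMean (particleWeight Q n) (n - 1 - i) (bump ε (t p))) atTop
      (𝓝 (meanTerm Q b₀ t p i)) := fun p =>
    tendsto_gasMean_meanTerm hQ H (htest p) (hcont p) p (hval p)
  have hlim2 : ∀ p i, Tendsto (fun n : ℕ => gasMean (particleWeight Q n) (n - 1 - i)
      (fun z => bump ε (t p) z * bump ε (t p) z)) atTop (𝓝 (meanTerm Q b₀ t p i)) := fun p =>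
    tendsto_gasMean_meanTerm hQ H ((htest p).mul (htest p)) ((hcont p).mul (hcont p)) p
      fun o => by rw [hval p o]; split_ifs <;> simp
  have hzero1 : ∀ p z, ‖z‖ ≤ t p - ε → bump ε (t p) z = 0 := fun p z hz =>
    bump_eq_zero hε (le_trans (by linarith) (neg_le_abs _))
  have hzero2 : ∀ p z, t p + ε ≤ ‖z‖ → bump ε (t p) z = 0 := fun p z hz =>
    bump_eq_zero hε (le_trans (by linarith) (le_abs_self _))
  -- The reference maximum is `b₀` (index `none`), and `r₁ = t p - ε` exceeds it by `hdrop`.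
  have hbd : ∀ p, ∃ C l : ℝ, 0 ≤ C ∧ 0 ≤ l ∧ l < 1 ∧ ∀ᶠ n : ℕ in atTop, ∀ i, i < n →
      |gasMean (particleWeight Q n) (n - 1 - i) (bump ε (t p))| ≤ C * l ^ i := fun p =>
    H.exists_gasMean_le hQ none (htest p) (hcont p) (bump_nonneg _ _) (hdrop p) (hzero1 p)
      (hzero2 p)
  have hbd2 : ∀ p, ∃ C l : ℝ, 0 ≤ C ∧ 0 ≤ l ∧ l < 1 ∧ ∀ᶠ n : ℕ in atTop, ∀ i, i < n →
      |gasMean (particleWeight Q n) (n - 1 - i) (fun z => bump ε (t p) z * bump ε (t p) z)| ≤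
        C * l ^ i := fun p =>
    H.exists_gasMean_le hQ none ((htest p).mul (htest p)) ((hcont p).mul (hcont p))
      (fun z => mul_nonneg (bump_nonneg _ _ _) (bump_nonneg _ _ _)) (hdrop p)
      (fun z hz => by rw [hzero1 p z hz, zero_mul]) (fun z hz => by rw [hzero2 p z hz, zero_mul])
  refine ⟨hprob, fun p => ?_, fun p => ?_, fun p q hpq => ?_⟩
  · obtain ⟨C, l, -, hl0, hl1, hb⟩ := hbd p
    obtain ⟨hsum, hten⟩ := tendsto_sum_reflect
      (f := fun n j => gasMean (particleWeight Q n) j (bump ε (t p))) hl0 hl1 (hlim p) hb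
    refine ⟨hsum, hten.congr' ?_⟩
    filter_upwards [eventually_gt_atTop 0] with n hn
    exact (integral_linearStatistic hQ hn (hM hn) (htest p)).symm
  · obtain ⟨C, l, hC, hl0, hl1, hb1⟩ := hbd p
    obtain ⟨C', l', hC', hl0', hl1', hb2⟩ := hbd2 p
    -- The variance of a Bernoulli variable with mean `meanTerm`; the last factor of `varTerm` is
    -- `heineDenom` minus the contribution of `p`.
    have hvar : ∀ i, meanTerm Q b₀ t p i - meanTerm Q b₀ t p i * meanTerm Q b₀ t p i =
        varTerm Q b₀ t p i := by
      intro i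
      have h1 : heineDenom Q b₀ t i = theta Q b₀ (t p) * rho b₀ (t p) ^ (2 * i + 1) +
          (1 + ∑ k ∈ Finset.univ.erase p, theta Q b₀ (t k) * rho b₀ (t k) ^ (2 * i + 1)) := by
        rw [heineDenom, ← Finset.add_sum_erase _ _ (Finset.mem_univ p)]
        ring
      have h2 := (hD i).ne'
      rw [varTerm, meanTerm, eq_sub_of_add_eq' h1.symm]
      field_simp
    obtain ⟨hsum, hten⟩ := tendsto_sum_reflect (L := varTerm Q b₀ t p) (C := C' + C * C)
      (l := max l l')
      (f := fun n j => gasMean (particleWeight Q n) j (fun z => bump ε (t p) z * bump ε (t p) z) -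
        gasMean (particleWeight Q n) j (bump ε (t p)) *
          gasMean (particleWeight Q n) j (bump ε (t p)))
      (le_max_of_le_left hl0) (max_lt hl1 hl1')
      (fun i => by
        rw [← hvar i]
        exact (hlim2 p i).sub ((hlim p i).mul (hlim p i)))
      (by
        filter_upwards [hb1, hb2] with n h1 h2 i hi
        have e1 := h1 i hi
        have e2 := h2 i hi
        have p1 : l ^ i ≤ max l l' ^ i := pow_le_pow_left₀ hl0 (le_max_left _ _) i
        have p2 : l' ^ i ≤ max l l' ^ i := pow_le_pow_left₀ hl0' (le_max_right _ _) i
        have p3 : l ^ i ≤ 1 := pow_le_one₀ hl0 hl1.le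
        have p4 : 0 ≤ l ^ i := pow_nonneg hl0 i
        refine (abs_sub _ _).trans ?_
        rw [abs_mul, add_mul]
        refine add_le_add (e2.trans (mul_le_mul_of_nonneg_left p2 hC')) ?_
        calc _ ≤ (C * l ^ i) * (C * 1) :=
              mul_le_mul e1 (e1.trans (mul_le_mul_of_nonneg_left p3 hC)) (abs_nonneg _)
                (mul_nonneg hC p4)
          _ = C * C * l ^ i := by ring
          _ ≤ _ := mul_le_mul_of_nonneg_left p1 (mul_nonneg hC hC))
    refine ⟨hsum, hten.congr' ?_⟩
    filter_upwards [eventually_gt_atTop 0] with n hn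
    have := hprob n hn
    rw [← covariance_linearStatistic hQ hn (hM hn) (htest p) (htest p)]
    exact covariance_self ((htest p).isRadialObservable (n := n)).measurable.aemeasurable
  · obtain ⟨C, l, hC, hl0, hl1, hb1⟩ := hbd p
    obtain ⟨C', l', hC', hl0', hl1', hb2⟩ := hbd q
    -- The cutoffs have disjoint supports, so the mean of the product is `0` and only minus the
    -- product of the means survives.
    have hcov : ∀ i, 0 - meanTerm Q b₀ t p i * meanTerm Q b₀ t q i = -covTerm Q b₀ t p q i := by
      intro i
      have h2 := (hD i).ne'
      rw [covTerm, meanTerm, meanTerm, mul_pow]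
      field_simp
      ring
    have hpq0 : (fun z => bump ε (t p) z * bump ε (t q) z) = fun _ => 0 :=
      funext (bump_mul_bump_eq_zero hε hsep hpq)
    -- One geometric factor suffices: the mean at `q` is bounded by the constant `C'`.
    obtain ⟨hsum, hten⟩ := tendsto_sum_reflect (L := fun i => -covTerm Q b₀ t p q i) (C := C * C')
      (f := fun n j => gasMean (particleWeight Q n) j (fun z => bump ε (t p) z * bump ε (t q) z) -
        gasMean (particleWeight Q n) j (bump ε (t p)) *
          gasMean (particleWeight Q n) j (bump ε (t q)))
      hl0 hl1
      (fun i => by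
        rw [← hcov i, hpq0]
        simp only [gasMean, mul_zero, integral_zero, zero_div]
        exact tendsto_const_nhds.sub ((hlim p i).mul (hlim q i)))
      (by
        filter_upwards [hb1, hb2] with n h1 h2 i hi
        have e1 := h1 i hi
        have e2 := h2 i hi
        have p3 : l' ^ i ≤ 1 := pow_le_one₀ hl0' hl1'.le
        have p4 : 0 ≤ l ^ i := pow_nonneg hl0 i
        have h0 : gasMean (particleWeight Q n) (n - 1 - i)
            (fun z => bump ε (t p) z * bump ε (t q) z) = 0 := by
          rw [hpq0]
          simp [gasMean]
        simp only [h0, zero_sub, abs_neg, abs_mul]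
        calc _ ≤ (C * l ^ i) * (C' * 1) :=
              mul_le_mul e1 (e2.trans (mul_le_mul_of_nonneg_left p3 hC')) (abs_nonneg _)
                (mul_nonneg hC p4)
          _ = C * C' * l ^ i := by ring)
    have hsum' : Summable (covTerm Q b₀ t p q) := by simpa using hsum.neg
    have hcpos : ∀ i, 0 < covTerm Q b₀ t p q i := by
      intro i
      have h2 := hD i
      have h3 : ∀ k, 0 < theta Q b₀ (t k) := fun k => Real.sqrt_pos.2 (div_pos hb (ht k))
      have h4 : ∀ k, 0 < rho b₀ (t k) := fun k => div_pos hb0 (htp k)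
      have := h3 p
      have := h3 q
      have := h4 p
      have := h4 q
      unfold covTerm
      positivity
    refine ⟨hsum', ?_, neg_lt_zero.2 (hsum'.tsum_pos (fun i => (hcpos i).le) 0 (hcpos 0))⟩
    rw [tsum_neg] at hten
    refine hten.congr' ?_
    filter_upwards [eventually_gt_atTop 0] with n hn
    exact (covariance_linearStatistic hQ hn (hM hn) (htest p) (htest q)).symm
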